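/- Let $k$ be a field and let $b,e,\ell,s$ be integers with $b\ge 2$ and $2\le s\le \ell\le e-3$. Put $b_{\ell+1}=b(\ell+1)+1-s$ and $b_{\ell+2}=(b-1)(\ell+2)+1$, and let $b_n$ ($\ell+3\le n\le e-1$) be any integers with $b_n\ge\lceil b/2\rceil n+1$ for $\ell+3\le n\le e-1$ and $b_{n+1}\le b_n+\lceil b/2\rceil$ for $\ell+2\le n\le e-2$. Let $$C=k[u^e,\,u^{be+1},\,u^{b_ne+n}\mid \ell+1\le n\le e-1]\subseteq k[u],$$ let $\mathfrak n$ be the graded maximal ideal of $C$ (generated by these monomials), $A=C_{\mathfrak n}$, $\mathfrak m=\mathfrak nA$ and $Q=u^eA$. Write $\ell_A(\cdot)$ for the length of an $A$-module and $\mathrm G(\mathfrak m)=\bigoplus_{n\ge0}\mathfrak m^n/\mathfrak m^{n+1}$ for the associated graded ring. Then: (0) $A$ is a Cohen–Macaulay local ring with $\dim A=1$ (with infinite residue field if $k$ is infinite), and $\mathfrak m$ is stretched with respect to $Q$: $Q$ is a parameter ideal of $A$ and a reduction of $\mathfrak m$, $Q\cap\mathfrak m^2=Q\mathfrak m$, and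 $\ell_A((\mathfrak m^2+Q)/(\mathfrak m^3+Q))=1$; (1) $n_Q(\mathfrak m):=\min\{n\ge0\mid\mathfrak m^{n+1}\subseteq Q\}=\ell$ and $r_Q(\mathfrak m):=\min\{n\ge0\mid\mathfrak m^{n+1}=Q\mathfrak m^n\}=\ell+1$, so $r_Q(\mathfrak m)=n_Q(\mathfrak m)+1$; (2) $\Lambda_Q(\mathfrak m):=\{n\ge1\mid (Q\mathfrak m^{n-1}\cap\mathfrak m^{n+1})/Q\mathfrak m^n\ne(0)\}=\{s\}$; (3) $\ell_A(A/\mathfrak m^{n+1})=e(n+1)-\left(e-1+\binom{\ell+1}{2}-s+1\right)$ for all $n\ge\ell$; (4) $\mathrm G(\mathfrak m)$ is not Cohen–Macaulay. -/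

import Mathlib

open Polynomial

noncomputable section

namespace StretchedIdeal

section General

variable (R : Type*) [CommRing R]

/-- A local ring is Cohen-Macaulay if it is Noetherian and has a regular sequence whose length is
the Krull dimension (over a local ring a regular sequence lies in the maximal ideal, and its length
never exceeds the dimension, so this is `depth R = dim R`). -/
def IsCohenMacaulayLocal [IsLocalRing R] : Prop :=
  IsNoetherianRing R ∧
    ∃ rs : List R, RingTheory.Sequence.IsRegular R rs ∧ (rs.length : WithBot ℕ∞) = ringKrullDim R

/-- A commutative ring is Cohen-Macaulay if it is Noetherian and its localizations at all maximal
ideals are Cohen-Macaulay local rings. -/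
def IsCohenMacaulay : Prop :=
  IsNoetherianRing R ∧
    ∀ (p : Ideal R) [p.IsMaximal], IsCohenMacaulayLocal (Localization.AtPrime p)

variable {R}

/-- The associated graded ring `G(I) = R(I) / I R(I) = ⨁ₙ Iⁿ / Iⁿ⁺¹`, where `R(I) = R[It]` is the
Rees algebra. -/
abbrev AssociatedGraded (I : Ideal R) : Type _ :=
  reesAlgebra I ⧸ I.map (algebraMap R (reesAlgebra I))

/-- The module `J / K` for ideals `K ⊆ J`. -/
abbrev SubQuot (J K : Ideal R) : Type _ := ↥J ⧸ Submodule.submoduleOf K J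

/-- A parameter ideal of a local ring of dimension `d`: an ideal primary to the maximal ideal that
is generated by `d` elements. -/
def IsParameterIdeal [IsLocalRing R] (Q : Ideal R) : Prop :=
  Q.radical = IsLocalRing.maximalIdeal R ∧
    ∃ (d : ℕ) (x : Fin d → R), ringKrullDim R = d ∧ Q = Ideal.span (Set.range x)

/-- `Q` is a reduction of `I`. -/
def IsReduction (Q I : Ideal R) : Prop := Q ≤ I ∧ ∃ n : ℕ, I ^ (n + 1) = Q * I ^ n

/-- The ideal `I`, primary to the maximal ideal, is stretched with respect to the parameter ideal
`Q`, which is a reduction of `I`. -/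
structure IsStretched [IsLocalRing R] (Q I : Ideal R) : Prop where
  primary : I.radical = IsLocalRing.maximalIdeal R
  parameter : IsParameterIdeal Q
  reduction : IsReduction Q I
  inf_sq : Q ⊓ I ^ 2 = Q * I
  length_eq_one : Module.length R (SubQuot (I ^ 2 ⊔ Q) (I ^ 3 ⊔ Q)) = 1

/-- The index of nilpotency `n_Q(I)` exists and equals `n`. -/
def IsNilpotencyIndex (Q I : Ideal R) (n : ℕ) : Prop := IsLeast {n : ℕ | I ^ (n + 1) ≤ Q} n

/-- The reduction number `r_Q(I)` exists and equals `r`. -/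
def IsReductionNumber (Q I : Ideal R) (r : ℕ) : Prop :=
  IsLeast {n : ℕ | I ^ (n + 1) = Q * I ^ n} r

/-- The set `Λ_Q(I)` of all `n ≥ 1` such that `(Q Iⁿ⁻¹ ∩ Iⁿ⁺¹) / Q Iⁿ ≠ 0`. -/
def Lam (Q I : Ideal R) : Set ℕ :=
  {n : ℕ | 1 ≤ n ∧ Nontrivial (SubQuot (Q * I ^ (n - 1) ⊓ I ^ (n + 1)) (Q * I ^ n))}

end General

section Example

variable (k : Type*) [Field k] (b e l : ℕ) (β : ℕ → ℕ)

/-- The generators `e`, `b e + 1` and `βₙ e + n` (for `l + 1 ≤ n ≤ e - 1`) of the numerical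
semigroup `H`. -/
def semigroupGens : Set ℕ :=
  {e, b * e + 1} ∪ {h : ℕ | ∃ n : ℕ, l + 1 ≤ n ∧ n < e ∧ h = β n * e + n}

/-- The numerical semigroup ring `C = k[H] ⊆ k[u]`. -/
def semigroupRing : Subalgebra k k[X] :=
  Algebra.adjoin k ((fun h : ℕ => (X : k[X]) ^ h) '' semigroupGens b e l β)

/-- The graded maximal ideal `𝔫` of `C`: the elements whose constant coefficient vanishes. For
`0 < e` it is generated by the monomials in the generators of `H`, see `gradedMax_eq_span`. -/
def gradedMax : Ideal (semigroupRing k b e l β) :=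
  RingHom.ker ((constantCoeff (R := k)).comp (semigroupRing k b e l β).val.toRingHom)

instance gradedMax_isPrime : (gradedMax k b e l β).IsPrime :=
  RingHom.ker_isPrime _

/-- The element `a = u ^ e` of `C`. -/
def elemA : semigroupRing k b e l β :=
  ⟨X ^ e, Algebra.subset_adjoin ⟨e, Or.inl (Or.inl rfl), rfl⟩⟩

/-- The local ring `A = C_𝔫`. -/
def LocRing : Type _ := Localization.AtPrime (gradedMax k b e l β)

instance : CommRing (LocRing k b e l β) :=
  inferInstanceAs (CommRing (Localization.AtPrime (gradedMax k b e l β)))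

instance : Algebra (semigroupRing k b e l β) (LocRing k b e l β) :=
  inferInstanceAs (Algebra (semigroupRing k b e l β) (Localization.AtPrime (gradedMax k b e l β)))

instance : IsLocalization.AtPrime (LocRing k b e l β) (gradedMax k b e l β) :=
  inferInstanceAs
    (IsLocalization.AtPrime (Localization.AtPrime (gradedMax k b e l β)) (gradedMax k b e l β))

instance : IsLocalRing (LocRing k b e l β) :=
  inferInstanceAs (IsLocalRing (Localization.AtPrime (gradedMax k b e l β)))

/-- The maximal ideal `𝔪` of `A`. -/
abbrev maxIdeal : Ideal (LocRing k b e l β) := IsLocalRing.maximalIdeal (LocRing k b e l β)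

/-- The ideal `Q = a A`. -/
def paramIdeal : Ideal (LocRing k b e l β) :=
  Ideal.span {algebraMap (semigroupRing k b e l β) (LocRing k b e l β) (elemA k b e l β)}

theorem gradedMax_eq_span (he : 0 < e) :
    gradedMax k b e l β =
      Ideal.span {x : semigroupRing k b e l β |
        ∃ h ∈ semigroupGens b e l β, (x : k[X]) = X ^ h} := by
  have hpos : ∀ h ∈ semigroupGens b e l β, h ≠ 0 := by
    rintro h ((rfl | rfl) | ⟨n, hn, -, rfl⟩) <;> omega
  apply le_antisymm
  · have key : ∀ (f : k[X]) (hf : f ∈ semigroupRing k b e l β),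
        (⟨f, hf⟩ : semigroupRing k b e l β) -
          algebraMap k (semigroupRing k b e l β) (constantCoeff f) ∈
          Ideal.span {x : semigroupRing k b e l β |
            ∃ h ∈ semigroupGens b e l β, (x : k[X]) = X ^ h} := by
      intro f hf
      induction hf using Algebra.adjoin_induction with
      | mem x hx =>
        obtain ⟨h, hh, rfl⟩ := hx
        have h0 : constantCoeff ((X : k[X]) ^ h) = 0 := by
          simp [Ne.symm (hpos h hh)]
        simp only [h0, map_zero, sub_zero]
        exact Ideal.subset_span ⟨h, hh, rfl⟩
      | algebraMap r =>
        convert Ideal.zero_mem _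
        ext1
        simp [Polynomial.algebraMap_eq]
      | add x y hx hy ihx ihy =>
        convert Ideal.add_mem _ ihx ihy using 1
        ext1
        simp
        ring
      | mul x y hx hy ihx ihy =>
        convert Ideal.add_mem _ (Ideal.mul_mem_left _ (⟨x, hx⟩ : semigroupRing k b e l β) ihy)
          (Ideal.mul_mem_left _ (algebraMap k (semigroupRing k b e l β) (constantCoeff y)) ihx)
          using 1
        ext1
        simp
        ring
    rintro ⟨f, hf⟩ hx
    have h0 : constantCoeff f = 0 := hx
    have := key f hf
    rwa [h0, map_zero, sub_zero] at this
  · rw [Ideal.span_le]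
    rintro x ⟨h, hh, hx⟩
    change constantCoeff (x : k[X]) = 0
    rw [hx]
    simp [Ne.symm (hpos h hh)]

end Example

end StretchedIdeal

end

/-! Everything is monomial, so the theorem reduces to counting in the numerical semigroup `H`
generated by `semigroupGens`. Each element of `H` is uniquely `(aperyQuot n + t) * e + n` with `n <
e`, and its order is the largest number of generators summing to it. For `n ≤ l` the best choice is
`n` copies of `b * e + 1` and `t` copies of `e`, of order `n + t`. For `n > l` one uses the
generator with residue `n` and `t` copies of `e`, of order `1 + t`. The only exception is `n = l +
1`: since `(l + 1) * (b * e + 1)` equals `(β (l + 1) + (s - 1)) * e + (l + 1)`, from `t = s - 1` on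
the copies of `b * e + 1` win, and the order is `l + 2 + t - s`.

That these values are correct is shown by `add_gen_mem_level` (adding a generator raises the order)
and `exists_gen_add` (a generator can be removed at the cost of one order). Together they give
`maxIdeal_pow`: `𝔪 ^ p` is the monomial ideal of exponents of order at least `p`.

The theorem is then read off from `monOrder`. Multiplication by `u ^ e` is the step `t ↦ t + 1`. It
raises the order by exactly one, except in residue `l + 1` from `t = s - 2` to `t = s - 1`, where
the order jumps from `s - 1` to `l + 1`. This single jump gives `Λ = {s}` and the reduction number
`l + 1`. At `t = 0` the orders are `0, ..., l` along the multiples of `b * e + 1` and `1` elsewhere,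
which gives stretchedness and nilpotency index `l`. The Hilbert function counts exponents residue by
residue. Finally, the monomial just before the jump has an initial form in the socle of the
associated graded ring, in which the initial form of `u ^ e` is not nilpotent, so that ring is not
Cohen–Macaulay. -/

open Polynomial

noncomputable section

namespace StretchedIdeal

/-! ### Orders of elements in the numerical semigroup. -/

section Semigroup

/-- The arithmetic conditions on the parameters of the semigroup, with `c = ⌈b / 2⌉`. -/
structure IsAdmissible (b e l s c : ℕ) (β : ℕ → ℕ) : Prop where
  lt_b : c + 1 ≤ b
  b_le : b ≤ 2 * c
  two_le_s : 2 ≤ s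
  s_le : s ≤ l
  le_e : l + 3 ≤ e
  β_one : β (l + 1) + s = b * (l + 1) + 1
  β_two : β (l + 2) + (l + 2) = b * (l + 2) + 1
  low : ∀ n : ℕ, l + 3 ≤ n → n < e → c * n + 1 ≤ β n
  step : ∀ n : ℕ, l + 2 ≤ n → n + 1 < e → β (n + 1) ≤ β n + c

/-- `aperyQuot n * e + n` is the smallest element of the semigroup congruent to `n` modulo `e`. -/
def aperyQuot (b l : ℕ) (β : ℕ → ℕ) (n : ℕ) : ℕ := if n ≤ l then b * n else β n

/-- The `𝔪`-adic order of the monomial with exponent `(aperyQuot n + t) * e + n`. -/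
def monOrder (l s n t : ℕ) : ℕ :=
  if n ≤ l then n + t else if n = l + 1 ∧ s ≤ t + 1 then l + 2 + t - s else 1 + t

/-- The exponents of the monomials of `𝔪`-adic order at least `p`. -/
def level (b e l s : ℕ) (β : ℕ → ℕ) (p : ℕ) : Set ℕ :=
  {h | ∃ n t, n < e ∧ h = (aperyQuot b l β n + t) * e + n ∧ p ≤ monOrder l s n t}

/-- The largest value of `monOrder l s n t - t`. -/
def orderGain (l s n : ℕ) : ℕ := if n ≤ l then n else if n = l + 1 then l + 2 - s else 1

variable {b e l s c : ℕ} {β : ℕ → ℕ}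

theorem monOrder_le (l s n t : ℕ) (hs : s ≤ l) : monOrder l s n t ≤ t + orderGain l s n := by
  unfold monOrder orderGain; split_ifs <;> omega

theorem le_monOrder (l s n t : ℕ) (hs : s ≤ l) : t ≤ monOrder l s n t := by
  unfold monOrder; split_ifs <;> omega

namespace IsAdmissible

theorem le_apery (H : IsAdmissible b e l s c β) {n : ℕ} (h1 : 1 ≤ n) (hn : n < e) :
    c * n + 1 ≤ aperyQuot b l β n := by
  have h : (c + 1) * n ≤ b * n := Nat.mul_le_mul_right _ H.lt_b
  rw [add_mul, one_mul] at h
  have := H.s_le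
  unfold aperyQuot
  split_ifs with h2
  · omega
  rcases Nat.lt_or_ge (l + 2) n with h3 | h3
  · exact H.low n h3 hn
  obtain rfl | rfl : n = l + 1 ∨ n = l + 2 := by omega
  · have := H.β_one; omega
  · have := H.β_two; omega

theorem β_add_le (H : IsAdmissible b e l s c β) {j : ℕ} (hj : l + 2 ≤ j) (i : ℕ) (h : j + i < e) :
    β (j + i) ≤ β j + c * i := by
  induction i with
  | zero => simp
  | succ i ih =>
    have h1 := ih (by omega)
    have h2 := H.step (j + i) (by omega) (by omega)
    rw [mul_add, ← add_assoc j]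
    omega

/-- The sum of an element of residue `n` and the generator of residue `j` has order at least `1 + t`
plus the surplus multiples of `e`; this bound makes the surplus pay for the order possibly lost from
residue `n`. For `j ≥ l + 2` it holds because `β` grows with slope at most `c` while `aperyQuot n ≥
c * n + orderGain n`. -/
theorem excess_nowrap (H : IsAdmissible b e l s c β) {n j : ℕ} (hn : 1 ≤ n) (hj : l + 1 ≤ j)
    (h : n + j < e) :
    aperyQuot b l β (n + j) + orderGain l s n ≤ aperyQuot b l β n + β j := by
  have hs := H.two_le_s
  have hsl := H.s_le
  have h1 := H.β_one
  have h2 := H.β_two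
  have hc (i : ℕ) : c * i + i ≤ b * i := by
    have : (c + 1) * i ≤ b * i := Nat.mul_le_mul_right _ H.lt_b
    rwa [add_mul, one_mul] at this
  have e1 : aperyQuot b l β (n + j) = β (n + j) := if_neg (by omega)
  rw [e1]
  -- The slope bound only starts at `l + 2`, so `j = l + 1` needs the explicit step `β (l + 2) - β
  -- (l + 1) = b + s - (l + 2) ≤ b - 2`.
  rcases Nat.lt_or_ge j (l + 2) with hj2 | hj2
  · obtain rfl : j = l + 1 := by omega
    have h4 := H.β_add_le le_rfl (n - 1) (by omega)
    have h5 : l + 2 + (n - 1) = n + (l + 1) := by omega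
    rw [h5] at h4
    have h6 := hc (n - 1)
    obtain ⟨m, rfl⟩ : ∃ m, n = m + 1 := ⟨n - 1, by omega⟩
    rw [Nat.add_sub_cancel] at h4 h6
    have h7 : b * (m + 1) = b * m + b := by ring
    have h8 : b * (l + 2) = b * (l + 1) + b := by ring
    unfold aperyQuot orderGain
    split_ifs with h9 h10
    · omega
    · obtain rfl : m = l := by omega
      omega
    · obtain ⟨i, rfl⟩ : ∃ i, m = l + 1 + i := ⟨m - (l + 1), by omega⟩
      have h11 := H.β_add_le le_rfl i (by omega)
      have h12 := H.β_add_le (j := l + 1 + i + 1) (by omega) (l + 1) (by omega)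
      have h13 := hc (l + 1)
      omega
  · have h4 := H.β_add_le hj2 n (by omega)
    rw [add_comm j n] at h4
    have h6 := hc n
    unfold aperyQuot orderGain
    split_ifs with h9 h10
    · omega
    · subst h10; omega
    · have := H.le_apery hn (by omega)
      unfold aperyQuot at this
      rw [if_neg h9] at this
      omega

/-- When the residues add up past `e`, the carry contributes the final `+ 1`. The inequality rests
on the lower bounds `c * i + 1` for both summands, against `b ≤ 2 * c` and `r < j` for the result.
-/
theorem excess_wrap (H : IsAdmissible b e l s c β) {n j r : ℕ} (hn : n < e) (hj : l + 1 ≤ j)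
    (hje : j < e) (h : n + j = e + r) :
    aperyQuot b l β r + orderGain l s n + 2 ≤ aperyQuot b l β n + β j + 1 := by
  have hs := H.two_le_s
  have hsl := H.s_le
  have hle := H.le_e
  have h1 := H.β_one
  have h2 := H.β_two
  have hc (i : ℕ) : c * i + i ≤ b * i := by
    have : (c + 1) * i ≤ b * i := Nat.mul_le_mul_right _ H.lt_b
    rwa [add_mul, one_mul] at this
  have hb (i : ℕ) : b * i ≤ c * i + c * i := by
    have : b * i ≤ (2 * c) * i := Nat.mul_le_mul_right _ H.b_le
    rw [mul_assoc] at this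
    omega
  have hj3 := H.le_apery (n := j) (by omega) hje
  have e1 : aperyQuot b l β j = β j := if_neg (by omega)
  rw [e1] at hj3
  obtain ⟨d, rfl⟩ : ∃ d, e = j + d := ⟨e - j, by omega⟩
  obtain rfl : n = d + r := by omega
  have e2 : b * (d + r) = b * d + b * r := by ring
  have hcj := hc j
  have hcd := hc d
  have hr : aperyQuot b l β r ≤ b * r := by
    unfold aperyQuot
    split_ifs with h3
    · rfl
    rcases Nat.lt_or_ge r (l + 2) with h4 | h4
    · obtain rfl : r = l + 1 := by omega
      omega
    · have h5 := H.β_add_le le_rfl (r - (l + 2)) (by omega)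
      obtain ⟨i, rfl⟩ : ∃ i, r = l + 2 + i := ⟨r - (l + 2), by omega⟩
      rw [Nat.add_sub_cancel_left] at h5
      have := hc i
      have : b * (l + 2 + i) = b * (l + 2) + b * i := by ring
      omega
  have hcj : j ≤ c * j := Nat.le_mul_of_pos_left _ (by have := H.lt_b; have := H.b_le; omega)
  by_cases h9 : d + r ≤ l
  · have : aperyQuot b l β (d + r) = b * (d + r) := if_pos h9
    have : orderGain l s (d + r) = d + r := if_pos h9
    omega
  by_cases h10 : d + r = l + 1
  · have : aperyQuot b l β (d + r) = β (l + 1) := by rw [h10]; exact if_neg (by omega)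
    have : orderGain l s (d + r) = l + 2 - s := by
      rw [h10]; unfold orderGain; rw [if_neg (by omega), if_pos rfl]
    rw [← h10] at h1
    have : β (d + r) = β (l + 1) := by rw [h10]
    omega
  have hg : orderGain l s (d + r) = 1 := by
    unfold orderGain; rw [if_neg h9, if_neg h10]
  have h11 := H.le_apery (n := d + r) (by omega) (by omega)
  have e3 : c * (d + r) = c * d + c * r := by ring
  have hcd' : d ≤ c * d := Nat.le_mul_of_pos_left _ (by have := H.lt_b; have := H.b_le; omega)
  by_cases h12 : r ≤ l
  · have hr2 : aperyQuot b l β r = b * r := if_pos h12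
    have := hb r
    have : c * r ≤ c * j := Nat.mul_le_mul_left _ (by omega)
    omega
  have hr3 : aperyQuot b l β r ≤ c * r + c * j := by
    unfold aperyQuot
    rw [if_neg h12]
    have : c * (l + 1) ≤ c * j := Nat.mul_le_mul_left _ (by omega)
    rcases Nat.lt_or_ge r (l + 2) with h4 | h4
    · obtain rfl : r = l + 1 := by omega
      have := hb (l + 1)
      omega
    · have h5 := H.β_add_le le_rfl (r - (l + 2)) (by omega)
      obtain ⟨i, rfl⟩ : ∃ i, r = l + 2 + i := ⟨r - (l + 2), by omega⟩
      rw [Nat.add_sub_cancel_left] at h5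
      have h13 : c * (l + 2 + i) = c * (l + 2) + c * i := by ring
      have : c * (l + 2) ≤ c * j := Nat.mul_le_mul_left _ (by omega)
      have := hb (l + 2)
      omega
  omega

theorem add_gen_mem_level (H : IsAdmissible b e l s c β) {p g h : ℕ}
    (hg : g ∈ semigroupGens b e l β) (hh : h ∈ level b e l s β p) :
    g + h ∈ level b e l s β (p + 1) := by
  have hs := H.two_le_s
  have hsl := H.s_le
  have hle := H.le_e
  have h1 := H.β_one
  have h2 := H.β_two
  obtain ⟨n, t, hn, rfl, hp⟩ := hh
  have hgain := monOrder_le l s n t hsl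
  obtain (rfl | rfl) | ⟨j, hj, hje, rfl⟩ := hg
  · refine ⟨n, t + 1, hn, by ring, ?_⟩
    unfold monOrder at *
    split_ifs at * <;> omega
  · rcases Nat.lt_or_ge n l with h3 | h3
    · refine ⟨n + 1, t, by omega, ?_, ?_⟩
      · have : aperyQuot b l β (n + 1) = aperyQuot b l β n + b := by
          unfold aperyQuot; rw [if_pos (by omega), if_pos (by omega)]; ring
        rw [this]; ring
      · unfold monOrder at *
        split_ifs at * <;> omega
    obtain rfl | h3 := h3.eq_or_lt
    -- The shift `s - 1` is the excess of `(l + 1) * (b * e + 1)` over the generator of residue `l +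
    -- 1`, in multiples of `e`.
    · refine ⟨l + 1, t + (s - 1), by omega, ?_, ?_⟩
      · have : aperyQuot b l β (l + 1) + (s - 1) = aperyQuot b l β l + b := by
          unfold aperyQuot
          rw [if_neg (by omega), if_pos (by omega)]
          have : b * (l + 1) = b * l + b := by ring
          omega
        have e2 : aperyQuot b l β (l + 1) + (t + (s - 1)) = aperyQuot b l β l + b + t := by omega
        rw [e2]; ring
      · unfold monOrder at *
        split_ifs at * <;> omega
    by_cases h4 : n = l + 1
    · subst h4
      -- The prescribed `β (l + 2)` makes this shift exactly large enough: after the jump in residue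
      -- `l + 1` the order must still grow by one.
      refine ⟨l + 2, t + (l + 2 - s), by omega, ?_, ?_⟩
      · have e1 : aperyQuot b l β (l + 2) + (l + 2 - s) = aperyQuot b l β (l + 1) + b := by
          unfold aperyQuot
          rw [if_neg (by omega), if_neg (by omega)]
          have : b * (l + 2) = b * (l + 1) + b := by ring
          omega
        have e2 : aperyQuot b l β (l + 2) + (t + (l + 2 - s)) =
          aperyQuot b l β (l + 1) + b + t := by omega
        rw [e2]; ring
      · unfold monOrder at *
        split_ifs at * <;> omega
    have e0 : aperyQuot b l β n = β n := if_neg (by omega)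
    have ho : monOrder l s n t = 1 + t := by
      unfold monOrder; rw [if_neg (by omega), if_neg (by omega)]
    have hb := H.lt_b
    have hb2 := H.b_le
    rcases Nat.lt_or_ge (n + 1) e with h5 | h5
    · have e1 : aperyQuot b l β (n + 1) = β (n + 1) := if_neg (by omega)
      have h6 := H.step n (by omega) h5
      refine ⟨n + 1, t + (β n + b - β (n + 1)), by omega, ?_, ?_⟩
      · have e2 : aperyQuot b l β (n + 1) + (t + (β n + b - β (n + 1))) = β n + b + t := by omega
        rw [e2, e0]; ring
      · have : monOrder l s (n + 1) (t + (β n + b - β (n + 1))) =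
            1 + (t + (β n + b - β (n + 1))) := by
          unfold monOrder; rw [if_neg (by omega), if_neg (by omega)]
        omega
    · obtain rfl : e = n + 1 := by omega
      refine ⟨0, t + (β n + b + 1), by omega, ?_, ?_⟩
      · rw [e0]; simp [aperyQuot]; ring
      · have := le_monOrder l s 0 (t + (β n + b + 1)) hsl
        omega
  · have e0 : aperyQuot b l β j = β j := if_neg (by omega)
    rcases Nat.eq_zero_or_pos n with rfl | hn0
    · refine ⟨j, t, hje, ?_, ?_⟩
      · rw [e0]; simp [aperyQuot]; ring
      · unfold monOrder at *
        split_ifs at * <;> omega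
    rcases Nat.lt_or_ge (n + j) e with h5 | h5
    · have h6 := H.excess_nowrap hn0 hj h5
      refine ⟨n + j, t + (aperyQuot b l β n + β j - aperyQuot b l β (n + j)), h5, ?_, ?_⟩
      · have e2 : aperyQuot b l β (n + j) +
          (t + (aperyQuot b l β n + β j - aperyQuot b l β (n + j))) =
          aperyQuot b l β n + β j + t := by omega
        rw [e2]; ring
      · have (T : ℕ) : monOrder l s (n + j) T = 1 + T := by
          unfold monOrder; rw [if_neg (by omega), if_neg (by omega)]
        rw [this]; omega
    · obtain ⟨r, hr⟩ : ∃ r, n + j = e + r := ⟨n + j - e, by omega⟩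
      have h6 := H.excess_wrap hn hj hje hr
      refine ⟨r, t + (aperyQuot b l β n + β j + 1 - aperyQuot b l β r), by omega, ?_, ?_⟩
      · have e2 : aperyQuot b l β r +
          (t + (aperyQuot b l β n + β j + 1 - aperyQuot b l β r)) =
          aperyQuot b l β n + β j + 1 + t := by omega
        rw [e2]
        calc β j * e + j + ((aperyQuot b l β n + t) * e + n)
            = (aperyQuot b l β n + β j + t) * e + (n + j) := by ring
          _ = _ := by rw [hr]; ring
      · have := le_monOrder l s r (t + (aperyQuot b l β n + β j + 1 - aperyQuot b l β r)) hsl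
        omega

/-- The generator removed is one occurring in the factorization that realizes `monOrder`: `e` for
residue `0`, `b * e + 1` where its multiples are optimal, otherwise the generator of the residue
itself. -/
theorem exists_gen_add (H : IsAdmissible b e l s c β) {p h : ℕ}
    (hh : h ∈ level b e l s β (p + 1)) :
    ∃ g ∈ semigroupGens b e l β, ∃ h' ∈ level b e l s β p, g + h' = h := by
  have hs := H.two_le_s
  have hsl := H.s_le
  have hle := H.le_e
  have h1 := H.β_one
  obtain ⟨n, t, hn, rfl, hp⟩ := hh
  rcases Nat.eq_zero_or_pos n with rfl | hn0
  · refine ⟨e, Or.inl (Or.inl rfl), _, ⟨0, t - 1, by omega, rfl, ?_⟩, ?_⟩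
    · unfold monOrder at *
      split_ifs at * <;> omega
    · obtain ⟨u, rfl⟩ : ∃ u, t = u + 1 := ⟨t - 1, by
        unfold monOrder at hp; rw [if_pos (by omega)] at hp; omega⟩
      simp; ring
  by_cases h3 : n ≤ l
  · refine ⟨b * e + 1, Or.inl (Or.inr rfl), _, ⟨n - 1, t, by omega, rfl, ?_⟩, ?_⟩
    · unfold monOrder at *
      split_ifs at * <;> omega
    · obtain ⟨u, rfl⟩ : ∃ u, n = u + 1 := ⟨n - 1, by omega⟩
      unfold aperyQuot
      rw [if_pos h3, if_pos (by omega), Nat.add_sub_cancel]; ring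
  by_cases h4 : n = l + 1 ∧ s ≤ t + 1
  · obtain ⟨rfl, h4⟩ := h4
    refine ⟨b * e + 1, Or.inl (Or.inr rfl), _, ⟨l, t + 1 - s, by omega, rfl, ?_⟩, ?_⟩
    · unfold monOrder at *
      split_ifs at * <;> omega
    · have : aperyQuot b l β (l + 1) + t = aperyQuot b l β l + (t + 1 - s) + b := by
        unfold aperyQuot
        rw [if_neg (by omega), if_pos (by omega)]
        have : b * (l + 1) = b * l + b := by ring
        omega
      rw [this]; ring
  · refine ⟨β n * e + n, Or.inr ⟨n, by omega, hn, rfl⟩, _, ⟨0, t, by omega, rfl, ?_⟩, ?_⟩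
    · unfold monOrder at *
      split_ifs at * <;> omega
    · unfold aperyQuot
      rw [if_neg h3, if_pos (by omega)]; ring

theorem zero_mem_level (H : IsAdmissible b e l s c β) : 0 ∈ level b e l s β 0 :=
  ⟨0, 0, by have := H.le_e; omega, by simp [aperyQuot], by simp⟩

theorem level_anti {p q : ℕ} (h : p ≤ q) : level b e l s β q ⊆ level b e l s β p := by
  rintro _ ⟨n, t, hn, rfl, hp⟩
  exact ⟨n, t, hn, rfl, h.trans hp⟩

theorem gen_mem_level (H : IsAdmissible b e l s c β) {g : ℕ} (hg : g ∈ semigroupGens b e l β) :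
    g ∈ level b e l s β 1 := by
  simpa using H.add_gen_mem_level hg H.zero_mem_level

theorem gen_pos (H : IsAdmissible b e l s c β) {g : ℕ} (hg : g ∈ semigroupGens b e l β) :
    0 < g := by
  have := H.le_e
  obtain (rfl | rfl) | ⟨j, hj, hje, rfl⟩ := hg <;> omega

theorem level_zero_cases {h : ℕ} (hh : h ∈ level b e l s β 0) :
    h = 0 ∨ h ∈ level b e l s β 1 := by
  obtain ⟨n, t, hn, rfl, -⟩ := hh
  rcases Nat.eq_zero_or_pos (monOrder l s n t) with h0 | h0
  · left
    unfold monOrder at h0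
    split_ifs at h0
    · obtain ⟨rfl, rfl⟩ : n = 0 ∧ t = 0 := by omega
      simp [aperyQuot]
    all_goals omega
  · exact Or.inr ⟨n, t, hn, rfl, h0⟩

theorem add_mem_level (H : IsAdmissible b e l s c β) {p q g h : ℕ}
    (hg : g ∈ level b e l s β q) (hh : h ∈ level b e l s β p) :
    g + h ∈ level b e l s β (p + q) := by
  induction g using Nat.strong_induction_on generalizing q with
  | _ g ih =>
    rcases q with _ | q
    · rcases level_zero_cases hg with rfl | hg1
      · simpa using hh
      · obtain ⟨a, ha, g', hg', rfl⟩ := H.exists_gen_add hg1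
        have := ih g' (by have := H.gen_pos ha; omega) hg'
        rw [add_assoc]
        exact level_anti (by omega) (H.add_gen_mem_level ha this)
    · obtain ⟨a, ha, g', hg', rfl⟩ := H.exists_gen_add hg
      have := ih g' (by have := H.gen_pos ha; omega) hg'
      rw [add_assoc, ← add_assoc p]
      exact H.add_gen_mem_level ha this

theorem mem_level_iff {p n t : ℕ} (hn : n < e) :
    (aperyQuot b l β n + t) * e + n ∈ level b e l s β p ↔ p ≤ monOrder l s n t := by
  refine ⟨?_, fun h => ⟨n, t, hn, rfl, h⟩⟩
  rintro ⟨n', t', hn', h, hp⟩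
  have he : 0 < e := by omega
  have h1 := congrArg (· % e) h
  have h2 := congrArg (· / e) h
  simp only [Nat.mul_add_mod_self_right, Nat.mod_eq_of_lt hn, Nat.mod_eq_of_lt hn'] at h1
  subst h1
  rw [mul_comm, mul_comm (_ + t') e] at h2
  simp only [Nat.mul_add_div he, Nat.div_eq_of_lt hn] at h2
  obtain rfl : t = t' := by omega
  exact hp

end IsAdmissible

end Semigroup

/-! ### Lengths of quotients by ideals. -/

theorem length_quotient_eq_add {R : Type*} [CommRing R] {K J : Ideal R} (h : K ≤ J) :
    Module.length R (R ⧸ K) = Module.length R (SubQuot J K) + Module.length R (R ⧸ J) := by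
  change _ = Module.length R (J ⧸ Submodule.comap (Submodule.subtype J) K) + _
  refine Module.length_eq_add_of_exact
    (Submodule.mapQ (Submodule.comap (Submodule.subtype J) K) K (Submodule.subtype J) le_rfl)
    (Submodule.factor h) ?_ (Submodule.factor_surjective h) ?_
  · rw [← LinearMap.ker_eq_bot, Submodule.ker_mapQ]
    exact Submodule.mkQ_map_self _
  · rw [LinearMap.exact_iff, Submodule.range_mapQ, Submodule.range_subtype, Submodule.factor,
      Submodule.ker_mapQ, Submodule.comap_id]

theorem nontrivial_subQuot_iff {R : Type*} [CommRing R] {J K : Ideal R} :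
    Nontrivial (SubQuot J K) ↔ ¬ J ≤ K := by
  rw [Submodule.Quotient.nontrivial_iff, Ne, Submodule.submoduleOf_eq_top]

section LocalAlgebra

variable {R : Type*} [CommRing R] [IsLocalRing R]

/-- The class of `y` modulo `K` is a nonzero socle element, so it spans a copy of the residue field.
-/
theorem covBy_sup_span_singleton {K : Ideal R} {y : R} (hy : y ∉ K)
    (h : ∀ r ∈ IsLocalRing.maximalIdeal R, r * y ∈ K) : K ⋖ K ⊔ Ideal.span {y} := by
  refine ⟨lt_of_le_of_ne le_sup_left fun h' => hy ?_, fun N hKN hN => ?_⟩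
  · rw [h']
    exact Ideal.mem_sup_right (Ideal.mem_span_singleton_self y)
  · obtain ⟨n, hnN, hnK⟩ := SetLike.exists_of_lt hKN
    refine hN.not_ge (sup_le hKN.le ((Ideal.span_singleton_le_iff_mem _).mpr ?_))
    obtain ⟨κ, hκ, z, hz, rfl⟩ := Submodule.mem_sup.mp (hN.le hnN)
    obtain ⟨r, rfl⟩ := Ideal.mem_span_singleton'.mp hz
    by_cases hr : r ∈ IsLocalRing.maximalIdeal R
    · exact absurd (K.add_mem hκ (h r hr)) hnK
    · have hu : IsUnit r := by simpa using hr
      rw [← Ideal.unit_mul_mem_iff_mem N hu]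
      exact (N.add_mem_iff_right (hKN.le hκ)).mp hnN

theorem length_subQuot_eq_one {K J : Ideal R} {y : R} (hJ : J = K ⊔ Ideal.span {y}) (hy : y ∉ K)
    (h : ∀ r ∈ IsLocalRing.maximalIdeal R, r * y ∈ K) : Module.length R (SubQuot J K) = 1 := by
  have hc := covBy_sup_span_singleton hy h
  rw [← hJ] at hc
  rw [Module.length_eq_one_iff]
  exact (covBy_iff_quot_is_simple hc.le).mp hc

end LocalAlgebra

/-! ### Socle elements and depth of the associated graded ring. -/

section AssociatedGraded

variable {R : Type*} [CommRing R]

theorem mem_map_reesAlgebra_iff (I : Ideal R) (f : reesAlgebra I) :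
    f ∈ I.map (algebraMap R (reesAlgebra I)) ↔ ∀ i, (f : R[X]).coeff i ∈ I ^ (i + 1) := by
  constructor
  · intro hf i
    induction hf using Submodule.span_induction generalizing i with
    | mem x hx =>
      obtain ⟨r, hr, rfl⟩ := hx
      change ((C r : R[X]).coeff i) ∈ _
      rw [coeff_C]
      split_ifs with h
      · subst h; simpa using hr
      · exact zero_mem _
    | zero => simp
    | add x y _ _ hx hy => simpa using add_mem (hx i) (hy i)
    | smul a x _ hx =>
      rw [smul_eq_mul, Subalgebra.coe_mul, coeff_mul]
      refine Ideal.sum_mem _ fun p hp => ?_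
      rw [← Finset.HasAntidiagonal.mem_antidiagonal.mp hp, add_assoc, pow_add]
      exact Ideal.mul_mem_mul (a.2 _) (hx _)
  · intro hf
    -- Writing `I ^ (i + 1)` as `I * I ^ i` moves one factor into the scalars and leaves a
    -- coefficient in `I ^ i`, which is still allowed in degree `i`.
    have key (i : ℕ) (r : R) (hr : r ∈ I ^ (i + 1)) :
        (⟨monomial i r, reesAlgebra.monomial_mem.mpr (Ideal.pow_le_pow_right (by omega) hr)⟩ :
          reesAlgebra I) ∈ I.map (algebraMap R (reesAlgebra I)) := by
      have hr' := hr
      rw [pow_succ'] at hr'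
      induction hr' using Submodule.mul_induction_on' with
      | mem_mul_mem a ha c hc =>
        have : (⟨monomial i (a * c), reesAlgebra.monomial_mem.mpr
            (Ideal.pow_le_pow_right (by omega) hr)⟩ : reesAlgebra I) =
            ⟨monomial i c, reesAlgebra.monomial_mem.mpr hc⟩ * algebraMap R (reesAlgebra I) a := by
          ext1
          change monomial i (a * c) = monomial i c * C a
          rw [monomial_mul_C, mul_comm]
        rw [this]
        exact Ideal.mul_mem_left _ _ (Ideal.mem_map_of_mem _ ha)
      | add x hx y hy ihx ihy =>
        rw [← pow_succ'] at hx hy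
        convert add_mem (ihx hx) (ihy hy) using 1
        ext1
        simp
    have : f = ∑ i ∈ (f : R[X]).support, (⟨monomial i ((f : R[X]).coeff i),
        reesAlgebra.monomial_mem.mpr (f.2 i)⟩ : reesAlgebra I) := by
      ext1
      rw [AddSubmonoidClass.coe_finsetSum]
      exact (f : R[X]).as_sum_support
    rw [this]
    exact Ideal.sum_mem _ fun i _ => key i _ (hf i)

/-- The kernel of `R(I) → R / J`, induced by taking the constant coefficient. -/
def reesAlgebraZeroIdeal (I J : Ideal R) : Ideal (reesAlgebra I) :=
  RingHom.ker ((Ideal.Quotient.mk J).comp (constantCoeff.comp (reesAlgebra I).val.toRingHom))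

theorem mem_reesAlgebraZeroIdeal {I J : Ideal R} {f : reesAlgebra I} :
    f ∈ reesAlgebraZeroIdeal I J ↔ (f : R[X]).coeff 0 ∈ J := by
  rw [reesAlgebraZeroIdeal, RingHom.mem_ker]
  exact Ideal.Quotient.eq_zero_iff_mem

instance reesAlgebraZeroIdeal_isMaximal (I J : Ideal R) [J.IsMaximal] :
    (reesAlgebraZeroIdeal I J).IsMaximal := by
  let := Ideal.Quotient.field J
  refine RingHom.ker_isMaximal_of_surjective _ ?_
  intro x
  obtain ⟨r, rfl⟩ := Ideal.Quotient.mk_surjective x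
  exact ⟨algebraMap R _ r, congrArg _ (coeff_C_zero (a := r))⟩

/-- If the localization at a maximal ideal which kills some nonzero element is Cohen-Macaulay,
then the maximal ideal is a nil ideal locally. -/
theorem exists_mul_pow_eq_zero_of_isCohenMacaulayLocal {p : Ideal R} [p.IsMaximal]
    (hCM : IsCohenMacaulayLocal (Localization.AtPrime p)) {ξ : R} (hξ : ξ ≠ 0)
    (hp : ∀ x ∈ p, x * ξ = 0) {x : R} (hx : x ∈ p) : ∃ σ ∉ p, ∃ n : ℕ, σ * x ^ n = 0 := by
  obtain ⟨-, rs, hrs, hdim⟩ := hCM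
  have hξ' : algebraMap R (Localization.AtPrime p) ξ ≠ 0 := by
    intro h0
    obtain ⟨⟨m, hm⟩, hm0⟩ := (IsLocalization.map_eq_zero_iff p.primeCompl _ _).mp h0
    obtain ⟨y, z, hz, hyz⟩ := (inferInstance : p.IsMaximal).exists_inv hm
    apply hξ
    calc ξ = (y * m + z) * ξ := by rw [hyz, one_mul]
      _ = y * (m * ξ) + z * ξ := by ring
      _ = 0 := by rw [hm0, hp z hz]; simp
  have hkill : ∀ r ∈ IsLocalRing.maximalIdeal (Localization.AtPrime p),
      r * algebraMap R (Localization.AtPrime p) ξ = 0 := by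
    intro r hr
    rw [← IsLocalization.AtPrime.map_eq_maximalIdeal p] at hr
    obtain ⟨⟨⟨a, ha⟩, m⟩, h⟩ := (IsLocalization.mem_map_algebraMap_iff p.primeCompl _).mp hr
    have hu := IsLocalization.map_units (Localization.AtPrime p) m
    rw [← hu.mul_right_eq_zero, ← mul_assoc, mul_comm (algebraMap R _ _) r, h, ← map_mul,
      hp a ha, map_zero]
  -- Every element of the maximal ideal kills the nonzero image of `ξ`, so no regular sequence can
  -- start and the dimension must be zero.
  have hnil : rs = [] := by
    rcases rs with _ | ⟨r, rs⟩
    · rfl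
    exfalso
    obtain ⟨hreg, -⟩ := (RingTheory.Sequence.isRegular_cons_iff _ _ _).mp hrs
    by_cases hr : r ∈ IsLocalRing.maximalIdeal (Localization.AtPrime p)
    · refine hξ' (hreg ?_)
      simpa using hkill r hr
    · apply hrs.top_ne_smul
      have hu : IsUnit r := by simpa using hr
      have : Ideal.ofList (r :: rs) = ⊤ :=
        Ideal.eq_top_of_isUnit_mem _ (Ideal.subset_span (by simp)) hu
      rw [this, Submodule.top_smul]
  subst hnil
  have h0 : Ring.KrullDimLE 0 (Localization.AtPrime p) := by
    rw [Ring.krullDimLE_iff, ← hdim]; simp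
  have hxm : algebraMap R (Localization.AtPrime p) x ∈
      IsLocalRing.maximalIdeal (Localization.AtPrime p) :=
    (IsLocalization.AtPrime.to_map_mem_maximal_iff _ p x).mpr hx
  have hxn : IsNilpotent (algebraMap R (Localization.AtPrime p) x) := by
    exact (Ring.KrullDimLE.isNilpotent_iff_mem_maximalIdeal).mpr hxm
  obtain ⟨n, hn⟩ := hxn
  rw [← map_pow] at hn
  obtain ⟨⟨m, hm⟩, hm0⟩ := (IsLocalization.map_eq_zero_iff p.primeCompl _ _).mp hn
  exact ⟨m, hm, n, hm0⟩

theorem exists_mul_pow_mem_of_isCohenMacaulay_quotient {K P : Ideal R} [P.IsMaximal] (hKP : K ≤ P)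
    (hCM : IsCohenMacaulay (R ⧸ K)) {ξ x : R} (hξ : ξ ∉ K) (hP : ∀ y ∈ P, y * ξ ∈ K)
    (hx : x ∈ P) : ∃ σ ∉ P, ∃ n : ℕ, σ * x ^ n ∈ K := by
  have hmem (f : R) : Ideal.Quotient.mk K f ∈ P.map (Ideal.Quotient.mk K) ↔ f ∈ P := by
    rw [← Ideal.mem_comap, Ideal.comap_map_of_surjective _ Ideal.Quotient.mk_surjective,
      ← RingHom.ker_eq_comap_bot, Ideal.mk_ker, sup_eq_left.mpr hKP]
  have : (P.map (Ideal.Quotient.mk K)).IsMaximal :=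
    Ideal.IsMaximal.map_of_surjective_of_ker_le Ideal.Quotient.mk_surjective
      (by rw [Ideal.mk_ker]; exact hKP)
  obtain ⟨σ, hσ, n, hn⟩ := exists_mul_pow_eq_zero_of_isCohenMacaulayLocal
    (hCM.2 (P.map (Ideal.Quotient.mk K))) (ξ := Ideal.Quotient.mk K ξ)
    (by rwa [Ne, Ideal.Quotient.eq_zero_iff_mem])
    (fun y hy => by
      obtain ⟨y, rfl⟩ := Ideal.Quotient.mk_surjective y
      rw [← map_mul, Ideal.Quotient.eq_zero_iff_mem]
      exact hP y ((hmem y).mp hy))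
    ((hmem x).mpr hx)
  obtain ⟨σ, rfl⟩ := Ideal.Quotient.mk_surjective σ
  rw [hmem] at hσ
  rw [← map_pow, ← map_mul, Ideal.Quotient.eq_zero_iff_mem] at hn
  exact ⟨σ, hσ, n, hn⟩

/-- A nonzero homogeneous socle element obstructs the Cohen-Macaulay property of the associated
graded ring of a local ring, unless its irrelevant maximal ideal is nil. -/
theorem not_isCohenMacaulay_associatedGraded {m : Ideal R} [m.IsMaximal] {j : ℕ} {ξ a : R}
    (hξ : ξ ∈ m ^ j) (hξ' : ξ ∉ m ^ (j + 1)) (hsocle : ∀ r ∈ m, r * ξ ∈ m ^ (j + 2))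
    (ha : a ∈ m) (hpow : ∀ n : ℕ, ∀ σ ∉ m, σ * a ^ n ∉ m ^ (n + 1)) :
    ¬ IsCohenMacaulay (AssociatedGraded m) := by
  intro hCM
  -- The maximal ideal used is the preimage in the Rees algebra of the irrelevant maximal ideal; `ξ`
  -- and `a` are placed in degrees `j` and `1`.
  have key := exists_mul_pow_mem_of_isCohenMacaulay_quotient
    (P := reesAlgebraZeroIdeal m m) (fun f hf => by
      have := (mem_map_reesAlgebra_iff m f).mp hf 0
      rw [zero_add, pow_one] at this
      exact mem_reesAlgebraZeroIdeal.mpr this) hCM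
    (ξ := ⟨monomial j ξ, reesAlgebra.monomial_mem.mpr hξ⟩)
    (x := ⟨monomial 1 a, reesAlgebra.monomial_mem.mpr (by simpa using ha)⟩) ?_ ?_ ?_
  · obtain ⟨σ, hσ, n, hn⟩ := key
    rw [mem_reesAlgebraZeroIdeal] at hσ
    rw [mem_map_reesAlgebra_iff] at hn
    have h := hn n
    rw [Subalgebra.coe_mul, Subalgebra.coe_pow, monomial_pow, one_mul] at h
    apply hpow n _ hσ
    have h2 := coeff_mul_monomial (σ : R[X]) n 0 (a ^ n)
    rw [zero_add] at h2
    rwa [h2] at h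
  · rw [mem_map_reesAlgebra_iff]
    intro h
    apply hξ'
    simpa using h j
  · intro f hf
    rw [mem_reesAlgebraZeroIdeal] at hf
    rw [mem_map_reesAlgebra_iff]
    intro i
    rw [Subalgebra.coe_mul]
    change ((f : R[X]) * monomial j ξ).coeff i ∈ _
    rcases Nat.lt_or_ge i j with hij | hij
    · rw [← C_mul_X_pow_eq_monomial, ← mul_assoc, coeff_mul_X_pow', if_neg (by omega)]
      exact zero_mem _
    obtain ⟨q, rfl⟩ := Nat.exists_eq_add_of_le' hij
    rw [coeff_mul_monomial]
    rcases q with _ | q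
    · rw [zero_add, pow_succ']
      exact Ideal.mul_mem_mul hf hξ
    -- A coefficient of positive degree `q + 1` lies in `m ^ q * m`, and its last factor gains an
    -- extra order on `ξ` by `hsocle`.
    · have hle : m * Ideal.span {ξ} ≤ m ^ (j + 2) := Ideal.mul_le.mpr fun r hr y hy => by
        obtain ⟨z, rfl⟩ := Ideal.mem_span_singleton'.mp hy
        rw [mul_left_comm]
        exact Ideal.mul_mem_left _ _ (hsocle r hr)
      have h1 : (f : R[X]).coeff (q + 1) * ξ ∈ m ^ (q + 1) * Ideal.span {ξ} :=
        Ideal.mul_mem_mul (f.2 (q + 1)) (Ideal.mem_span_singleton_self ξ)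
      have e : q + 1 + j + 1 = q + (j + 2) := by ring
      rw [e, pow_add]
      rw [pow_succ, mul_assoc] at h1
      exact Ideal.mul_mono_right hle h1
  · rw [mem_reesAlgebraZeroIdeal, coeff_monomial, if_neg (by omega)]
    exact zero_mem m

end AssociatedGraded

/-! ### Dictionary between semigroup ideals and monomial ideals of the local ring. -/

section MonomialIdeals

open scoped Pointwise

/-- Ideals of the semigroup `level b e l s β 0`. -/
structure IsSemigroupIdeal (b e l s : ℕ) (β : ℕ → ℕ) (S : Set ℕ) : Prop where
  subset : S ⊆ level b e l s β 0
  add_mem : ∀ g ∈ level b e l s β 0, ∀ h ∈ S, g + h ∈ S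

variable (k : Type*) [Field k] {b e l s c : ℕ} {β : ℕ → ℕ}

theorem IsAdmissible.isSemigroupIdeal_level (H : IsAdmissible b e l s c β) (p : ℕ) :
    IsSemigroupIdeal b e l s β (level b e l s β p) :=
  ⟨level_anti (Nat.zero_le p), fun _ hg _ hh => H.add_mem_level hg hh⟩

theorem IsAdmissible.isSemigroupIdeal_add_level (H : IsAdmissible b e l s c β) {g : ℕ}
    (hg : g ∈ level b e l s β 0) (p : ℕ) :
    IsSemigroupIdeal b e l s β ({g} + level b e l s β p) := by
  constructor
  · rintro _ ⟨_, rfl, h, hh, rfl⟩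
    exact H.add_mem_level hg (level_anti (Nat.zero_le p) hh)
  · rintro a ha _ ⟨_, rfl, h, hh, rfl⟩
    refine ⟨_, rfl, a + h, H.add_mem_level ha hh, ?_⟩
    simp only
    ring

theorem IsSemigroupIdeal.inter {S T : Set ℕ} (hS : IsSemigroupIdeal b e l s β S)
    (hT : IsSemigroupIdeal b e l s β T) : IsSemigroupIdeal b e l s β (S ∩ T) :=
  ⟨fun _ h => hS.subset h.1, fun g hg h hh => ⟨hS.add_mem g hg h hh.1, hT.add_mem g hg h hh.2⟩⟩

theorem IsSemigroupIdeal.union {S T : Set ℕ} (hS : IsSemigroupIdeal b e l s β S)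
    (hT : IsSemigroupIdeal b e l s β T) : IsSemigroupIdeal b e l s β (S ∪ T) :=
  ⟨Set.union_subset hS.subset hT.subset,
    fun g hg h hh => hh.imp (hS.add_mem g hg h) (hT.add_mem g hg h)⟩

theorem IsAdmissible.add_level (H : IsAdmissible b e l s c β) (p : ℕ) :
    semigroupGens b e l β + level b e l s β p = level b e l s β (p + 1) := by
  ext h
  constructor
  · rintro ⟨g, hg, h, hh, rfl⟩
    exact H.add_gen_mem_level hg hh
  · intro hh
    obtain ⟨g, hg, h', hh', rfl⟩ := H.exists_gen_add hh
    exact ⟨g, hg, h', hh', rfl⟩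

theorem IsAdmissible.X_pow_mem (H : IsAdmissible b e l s c β) {h : ℕ}
    (hh : h ∈ level b e l s β 0) : (X : k[X]) ^ h ∈ semigroupRing k b e l β := by
  induction h using Nat.strong_induction_on with
  | _ h ih =>
    rcases level_zero_cases hh with rfl | hh
    · simp
    · obtain ⟨g, hg, h', hh', rfl⟩ := H.exists_gen_add hh
      rw [pow_add]
      exact mul_mem (Algebra.subset_adjoin ⟨g, hg, rfl⟩)
        (ih h' (by have := H.gen_pos hg; omega) hh')

theorem exists_coeff_ne_zero_of_mul {f g : k[X]} {h : ℕ} (hfg : (f * g).coeff h ≠ 0) :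
    ∃ i j, i + j = h ∧ f.coeff i ≠ 0 ∧ g.coeff j ≠ 0 := by
  rw [coeff_mul] at hfg
  obtain ⟨p, hp, hne⟩ := Finset.exists_ne_zero_of_sum_ne_zero hfg
  exact ⟨p.1, p.2, Finset.HasAntidiagonal.mem_antidiagonal.mp hp, left_ne_zero_of_mul hne,
    right_ne_zero_of_mul hne⟩

theorem IsAdmissible.mem_level_of_coeff_ne_zero (H : IsAdmissible b e l s c β) {f : k[X]}
    (hf : f ∈ semigroupRing k b e l β) {h : ℕ} (hh : f.coeff h ≠ 0) : h ∈ level b e l s β 0 := by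
  induction hf using Algebra.adjoin_induction generalizing h with
  | mem x hx =>
    obtain ⟨g, hg, rfl⟩ := hx
    simp only [coeff_X_pow, ne_eq, ite_eq_right_iff, one_ne_zero, imp_false, not_not] at hh
    subst hh
    exact level_anti (Nat.zero_le 1) (H.gen_mem_level hg)
  | algebraMap r =>
    rw [Polynomial.algebraMap_eq, coeff_C] at hh
    have : h = 0 := by_contra fun h0 => hh (if_neg h0)
    subst this
    exact H.zero_mem_level
  | add x y _ _ hx hy =>
    rw [coeff_add] at hh
    by_cases h0 : x.coeff h = 0
    · exact hy (by rwa [h0, zero_add] at hh)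
    · exact hx h0
  | mul x y _ _ hx hy =>
    obtain ⟨i, j, rfl, hi, hj⟩ := exists_coeff_ne_zero_of_mul k hh
    exact H.add_mem_level (hx hi) (hy hj)

variable (b e l β) in
/-- The ideal of the semigroup ring generated by the monomials with exponents in `S`. -/
def monIdeal (S : Set ℕ) : Ideal (semigroupRing k b e l β) :=
  Ideal.span {x : semigroupRing k b e l β | ∃ h ∈ S, (x : k[X]) = X ^ h}

variable {k}

/-- Since `S` absorbs addition from `H`, multiplying a monomial with exponent in `S` by any ring
element keeps the support in `S`. -/
theorem IsAdmissible.mem_monIdeal_iff (H : IsAdmissible b e l s c β) {S : Set ℕ}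
    (hS : IsSemigroupIdeal b e l s β S) (f : semigroupRing k b e l β) :
    f ∈ monIdeal k b e l β S ↔ ∀ h, (f : k[X]).coeff h ≠ 0 → h ∈ S := by
  constructor
  · intro hf
    induction hf using Submodule.span_induction with
    | mem x hx =>
      obtain ⟨g, hg, hx⟩ := hx
      intro h hh
      rw [hx, coeff_X_pow] at hh
      have : h = g := by_contra fun h0 => hh (if_neg h0)
      rwa [this]
    | zero => simp
    | add x y _ _ hx hy =>
      intro h hh
      rw [Subalgebra.coe_add, coeff_add] at hh
      by_cases h0 : (x : k[X]).coeff h = 0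
      · exact hy h (by rwa [h0, zero_add] at hh)
      · exact hx h h0
    | smul a x _ hx =>
      intro h hh
      rw [smul_eq_mul, Subalgebra.coe_mul] at hh
      obtain ⟨i, j, rfl, hi, hj⟩ := exists_coeff_ne_zero_of_mul k hh
      exact hS.add_mem i (H.mem_level_of_coeff_ne_zero k a.2 hi) j (hx j hj)
  · intro hf
    have hmem (h : (f : k[X]).support) : (X : k[X]) ^ (h : ℕ) ∈ semigroupRing k b e l β :=
      H.X_pow_mem k (hS.subset (hf h (mem_support_iff.mp h.2)))
    have : f = ∑ h : (f : k[X]).support,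
        algebraMap k (semigroupRing k b e l β) ((f : k[X]).coeff h) * ⟨X ^ (h : ℕ), hmem h⟩ := by
      ext1
      rw [AddSubmonoidClass.coe_finsetSum]
      conv_lhs => rw [(f : k[X]).as_sum_support_C_mul_X_pow]
      rw [← Finset.sum_coe_sort]
      rfl
    rw [this]
    exact Ideal.sum_mem _ fun h _ => Ideal.mul_mem_left _ _
      (Ideal.subset_span ⟨h, hf h (mem_support_iff.mp h.2), rfl⟩)

theorem IsAdmissible.monIdeal_mul (H : IsAdmissible b e l s c β) {S T : Set ℕ}
    (hS : S ⊆ level b e l s β 0) (hT : T ⊆ level b e l s β 0) :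
    monIdeal k b e l β S * monIdeal k b e l β T = monIdeal k b e l β (S + T) := by
  rw [monIdeal, monIdeal, Ideal.span_mul_span', monIdeal]
  congr 1
  ext x
  constructor
  · rintro ⟨y, ⟨g, hg, hy⟩, z, ⟨h, hh, hz⟩, rfl⟩
    refine ⟨g + h, ⟨g, hg, h, hh, rfl⟩, ?_⟩
    rw [pow_add, ← hy, ← hz]; rfl
  · rintro ⟨_, ⟨g, hg, h, hh, rfl⟩, hx⟩
    refine ⟨⟨X ^ g, H.X_pow_mem k (hS hg)⟩, ⟨g, hg, rfl⟩, ⟨X ^ h, H.X_pow_mem k (hT hh)⟩,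
      ⟨h, hh, rfl⟩, ?_⟩
    ext1
    rw [hx]
    exact (pow_add _ _ _).symm

variable (k b e l β)

/-- The extension of `monIdeal k b e l β S` to the local ring. -/
def locIdeal (S : Set ℕ) : Ideal (LocRing k b e l β) :=
  (monIdeal k b e l β S).map (algebraMap (semigroupRing k b e l β) (LocRing k b e l β))

open Classical in
/-- The image of the monomial `X ^ h` in the local ring, provided that the monomial belongs to
the semigroup ring. -/
def locMon (h : ℕ) : LocRing k b e l β :=
  if hh : (X : k[X]) ^ h ∈ semigroupRing k b e l β then
    algebraMap (semigroupRing k b e l β) (LocRing k b e l β) ⟨X ^ h, hh⟩ else 0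

theorem locIdeal_union (S T : Set ℕ) :
    locIdeal k b e l β (S ∪ T) = locIdeal k b e l β S ⊔ locIdeal k b e l β T := by
  rw [locIdeal, locIdeal, locIdeal, ← Ideal.map_sup, monIdeal, monIdeal, monIdeal,
    ← Ideal.span_union]
  congr 2
  ext x
  simp only [Set.mem_ofPred_eq, Set.mem_union, or_and_right, exists_or]

theorem locIdeal_mono {S T : Set ℕ} (h : S ⊆ T) : locIdeal k b e l β S ≤ locIdeal k b e l β T :=
  Ideal.map_mono (Ideal.span_mono fun _ ⟨g, hg, hx⟩ => ⟨g, h hg, hx⟩)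

namespace IsAdmissible

variable {b e l β}

theorem locMon_eq (H : IsAdmissible b e l s c β) {h : ℕ} (hh : h ∈ level b e l s β 0) :
    locMon k b e l β h =
      algebraMap (semigroupRing k b e l β) (LocRing k b e l β) ⟨X ^ h, H.X_pow_mem k hh⟩ :=
  dif_pos _

theorem locMon_mem (H : IsAdmissible b e l s c β) {S : Set ℕ} {h : ℕ}
    (hh : h ∈ level b e l s β 0) (hS : h ∈ S) : locMon k b e l β h ∈ locIdeal k b e l β S := by
  rw [H.locMon_eq k hh]
  exact Ideal.mem_map_of_mem _ (Ideal.subset_span ⟨h, hS, rfl⟩)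

theorem locMon_add (H : IsAdmissible b e l s c β) {g h : ℕ} (hg : g ∈ level b e l s β 0)
    (hh : h ∈ level b e l s β 0) :
    locMon k b e l β (g + h) = locMon k b e l β g * locMon k b e l β h := by
  rw [H.locMon_eq k hg, H.locMon_eq k hh, H.locMon_eq k (H.add_mem_level hg hh), ← map_mul]
  congr 1
  ext1
  exact pow_add _ _ _

theorem locIdeal_singleton (H : IsAdmissible b e l s c β) {h : ℕ}
    (hh : h ∈ level b e l s β 0) :
    locIdeal k b e l β {h} = Ideal.span {locMon k b e l β h} := by
  rw [H.locMon_eq k hh, ← Set.image_singleton, ← Ideal.map_span, locIdeal, monIdeal]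
  congr 2
  ext x
  simp only [Set.mem_singleton_iff, exists_eq_left, Set.mem_ofPred_eq]
  exact ⟨fun h' => Subtype.ext h', fun h' => congrArg Subtype.val h'⟩

/-- Localization loses nothing on monomials: a denominator `σ` outside `𝔫` has nonzero constant
term, so `σ * X ^ h` still has `h` in its support. -/
theorem locMon_mem_iff (H : IsAdmissible b e l s c β) {S : Set ℕ}
    (hS : IsSemigroupIdeal b e l s β S) {h : ℕ} (hh : h ∈ level b e l s β 0) :
    locMon k b e l β h ∈ locIdeal k b e l β S ↔ h ∈ S := by
  refine ⟨fun hm => ?_, H.locMon_mem k hh⟩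
  rw [H.locMon_eq k hh, locIdeal, IsLocalization.algebraMap_mem_map_algebraMap_iff
    (gradedMax k b e l β).primeCompl] at hm
  obtain ⟨σ, hσ, hm⟩ := hm
  refine (H.mem_monIdeal_iff hS _).mp hm h ?_
  rw [Subalgebra.coe_mul]
  have := coeff_mul_X_pow (σ : k[X]) h 0
  rw [zero_add] at this
  change ((σ : k[X]) * X ^ h).coeff h ≠ 0
  rw [this]
  exact fun h0 => hσ h0

theorem locIdeal_le_iff (H : IsAdmissible b e l s c β) {S T : Set ℕ}
    (hS : S ⊆ level b e l s β 0) (hT : IsSemigroupIdeal b e l s β T) :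
    locIdeal k b e l β S ≤ locIdeal k b e l β T ↔ S ⊆ T :=
  ⟨fun h _ hg => (H.locMon_mem_iff k hT (hS hg)).mp (h (H.locMon_mem k (hS hg) hg)),
    locIdeal_mono k b e l β⟩

theorem locIdeal_inf (H : IsAdmissible b e l s c β) {S T : Set ℕ}
    (hS : IsSemigroupIdeal b e l s β S) (hT : IsSemigroupIdeal b e l s β T) :
    locIdeal k b e l β S ⊓ locIdeal k b e l β T = locIdeal k b e l β (S ∩ T) := by
  rw [locIdeal, locIdeal, ← IsLocalization.map_inf (gradedMax k b e l β).primeCompl, locIdeal]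
  congr 1
  ext f
  rw [Submodule.mem_inf, H.mem_monIdeal_iff hS, H.mem_monIdeal_iff hT,
    H.mem_monIdeal_iff (hS.inter hT)]
  exact ⟨fun h i hi => ⟨h.1 i hi, h.2 i hi⟩, fun h => ⟨fun i hi => (h i hi).1,
    fun i hi => (h i hi).2⟩⟩

theorem locIdeal_mul (H : IsAdmissible b e l s c β) {S T : Set ℕ}
    (hS : S ⊆ level b e l s β 0) (hT : T ⊆ level b e l s β 0) :
    locIdeal k b e l β S * locIdeal k b e l β T = locIdeal k b e l β (S + T) := by
  rw [locIdeal, locIdeal, ← Ideal.map_mul, H.monIdeal_mul hS hT, locIdeal]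

theorem locIdeal_level_zero (H : IsAdmissible b e l s c β) :
    locIdeal k b e l β (level b e l s β 0) = ⊤ := by
  rw [Ideal.eq_top_iff_one]
  have := H.locMon_mem k H.zero_mem_level H.zero_mem_level
  rw [H.locMon_eq k H.zero_mem_level] at this
  convert! this
  rw [← map_one (algebraMap (semigroupRing k b e l β) (LocRing k b e l β))]
  congr 1

theorem gens_subset (H : IsAdmissible b e l s c β) :
    semigroupGens b e l β ⊆ level b e l s β 0 :=
  fun _ hg => level_anti (Nat.zero_le 1) (H.gen_mem_level hg)

/-- This turns the `𝔪`-adic filtration into the combinatorial one; the induction step is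
`add_level`. -/
theorem maxIdeal_pow (H : IsAdmissible b e l s c β) (p : ℕ) :
    maxIdeal k b e l β ^ p = locIdeal k b e l β (level b e l s β p) := by
  have h1 : maxIdeal k b e l β = locIdeal k b e l β (semigroupGens b e l β) := by
    rw [maxIdeal, ← IsLocalization.AtPrime.map_eq_maximalIdeal (gradedMax k b e l β),
      gradedMax_eq_span k b e l β (by have := H.le_e; omega)]
    rfl
  induction p with
  | zero => rw [pow_zero, H.locIdeal_level_zero k, Ideal.one_eq_top]
  | succ p ih =>
    rw [pow_succ', ih, h1, H.locIdeal_mul k H.gens_subset (level_anti (Nat.zero_le p)), H.add_level]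

theorem e_mem (H : IsAdmissible b e l s c β) : e ∈ level b e l s β 0 :=
  H.gens_subset (Or.inl (Or.inl rfl))

theorem paramIdeal_eq_span (H : IsAdmissible b e l s c β) :
    paramIdeal k b e l β = Ideal.span {locMon k b e l β e} := by
  rw [H.locMon_eq k H.e_mem]
  rfl

theorem paramIdeal_mul_pow (H : IsAdmissible b e l s c β) (p : ℕ) :
    paramIdeal k b e l β * maxIdeal k b e l β ^ p =
      locIdeal k b e l β ({e} + level b e l s β p) := by
  rw [H.paramIdeal_eq_span k, ← H.locIdeal_singleton k H.e_mem, H.maxIdeal_pow k,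
    H.locIdeal_mul k (Set.singleton_subset_iff.mpr H.e_mem) (level_anti (Nat.zero_le p))]

theorem paramIdeal_eq (H : IsAdmissible b e l s c β) :
    paramIdeal k b e l β = locIdeal k b e l β ({e} + level b e l s β 0) := by
  rw [← H.paramIdeal_mul_pow k, pow_zero, mul_one]

/-- A maximal ideal times a monomial is contained in a monomial ideal as soon as the products of
the monomial with the other monomials are. -/
theorem mul_locMon_mem (H : IsAdmissible b e l s c β) {S : Set ℕ} {h : ℕ}
    (hh : h ∈ level b e l s β 0) (hS : ∀ g ∈ level b e l s β 1, g + h ∈ S)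
    {r : LocRing k b e l β} (hr : r ∈ maxIdeal k b e l β) :
    r * locMon k b e l β h ∈ locIdeal k b e l β S := by
  rw [← pow_one (maxIdeal k b e l β), H.maxIdeal_pow k] at hr
  have := Ideal.mul_mem_mul hr (Ideal.mem_span_singleton_self (locMon k b e l β h))
  rw [← H.locIdeal_singleton k hh, H.locIdeal_mul k (level_anti (Nat.zero_le 1))
    (Set.singleton_subset_iff.mpr hh)] at this
  refine locIdeal_mono k b e l β ?_ this
  rintro _ ⟨g, hg, _, rfl, rfl⟩
  exact hS g hg

/-- Adjoining to `S` the largest missing exponent gives again a semigroup ideal and contributes one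
composition factor. -/
theorem length_quotient_locIdeal (H : IsAdmissible b e l s c β) {S : Set ℕ}
    (hS : IsSemigroupIdeal b e l s β S) (hfin : (level b e l s β 0 \ S).Finite) :
    Module.length (LocRing k b e l β) (LocRing k b e l β ⧸ locIdeal k b e l β S) =
      (level b e l s β 0 \ S).ncard := by
  induction hn : (level b e l s β 0 \ S).ncard generalizing S with
  | zero =>
    rw [Set.ncard_eq_zero hfin, Set.sdiff_eq_empty] at hn
    obtain rfl := hn.antisymm hS.subset
    rw [H.locIdeal_level_zero k]
    simp
  | succ N ih =>
    have hne : (level b e l s β 0 \ S).Nonempty := by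
      rw [← Set.ncard_pos hfin]; omega
    obtain ⟨h, ⟨hh, hhS⟩, hmax⟩ := Set.exists_max_image _ id hfin hne
    have hprod : ∀ g ∈ level b e l s β 1, g + h ∈ S := by
      intro g hg
      by_contra hgS
      have h1 := hmax (g + h) ⟨H.add_mem_level (level_anti (Nat.zero_le 1) hg) hh, hgS⟩
      obtain ⟨a, ha, g', -, rfl⟩ := H.exists_gen_add hg
      have := H.gen_pos ha
      simp only [id] at h1
      omega
    have hT : IsSemigroupIdeal b e l s β (S ∪ {h}) := by
      refine ⟨Set.union_subset hS.subset (Set.singleton_subset_iff.mpr hh), ?_⟩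
      rintro g hg x (hx | rfl)
      · exact Or.inl (hS.add_mem g hg x hx)
      · rcases level_zero_cases hg with rfl | hg
        · right; simp
        · exact Or.inl (hprod g hg)
    have hdiff : level b e l s β 0 \ (S ∪ {h}) = (level b e l s β 0 \ S) \ {h} :=
      Set.sdiff_sdiff.symm
    have hcard : (level b e l s β 0 \ (S ∪ {h})).ncard = N := by
      rw [hdiff, Set.ncard_sdiff_singleton_of_mem (Set.mem_sdiff_of_mem hh hhS), hn, Nat.add_sub_cancel]
    rw [length_quotient_eq_add (locIdeal_mono k b e l β (Set.subset_union_left (t := {h}))),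
      ih hT (hfin.subset (Set.sdiff_subset_sdiff_right Set.subset_union_left)) hcard,
      length_subQuot_eq_one (y := locMon k b e l β h)
        (by rw [locIdeal_union, H.locIdeal_singleton k hh])
        (by rwa [H.locMon_mem_iff k hS hh]) (fun r hr => H.mul_locMon_mem k hh hprod hr)]
    push_cast
    ring

end IsAdmissible

end MonomialIdeals

/-! ### The invariants computed on exponents. -/

section LevelSets

open scoped Pointwise

variable {b e l s c : ℕ} {β : ℕ → ℕ}

namespace IsAdmissible

theorem mem_e_add_level_iff {p n t : ℕ} (hn : n < e) :
    (aperyQuot b l β n + t) * e + n ∈ {e} + level b e l s β p ↔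
      ∃ t', t = t' + 1 ∧ p ≤ monOrder l s n t' := by
  constructor
  · rintro ⟨a, ha, _, ⟨n', t', hn', rfl, hp⟩, h⟩
    rw [Set.mem_singleton_iff.mp ha] at h
    have h1 : (aperyQuot b l β n + t) * e + n = (aperyQuot b l β n' + (t' + 1)) * e + n' := by
      rw [← h]; simp only; ring
    have h2 := congrArg (· % e) h1
    simp only [Nat.mul_add_mod_self_right, Nat.mod_eq_of_lt hn, Nat.mod_eq_of_lt hn'] at h2
    subst h2
    have h3 := Nat.eq_of_mul_eq_mul_right (by omega) (Nat.add_right_cancel h1)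
    exact ⟨t', by omega, hp⟩
  · rintro ⟨t', rfl, hp⟩
    exact ⟨e, rfl, _, ⟨n, t', hn, rfl, hp⟩, by simp only; ring⟩

theorem e_add_level_subset (H : IsAdmissible b e l s c β) (p : ℕ) :
    {e} + level b e l s β p ⊆ level b e l s β (p + 1) := by
  rintro _ ⟨_, rfl, h, hh, rfl⟩
  exact H.add_gen_mem_level (Or.inl (Or.inl rfl)) hh

theorem inter_level_two (H : IsAdmissible b e l s c β) :
    ({e} + level b e l s β 0) ∩ level b e l s β 2 = {e} + level b e l s β 1 := by
  have hs := H.two_le_s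
  have hsl := H.s_le
  apply Set.Subset.antisymm
  · rintro _ ⟨h1, n, t, hn, rfl, hp⟩
    obtain ⟨t', rfl, -⟩ := (mem_e_add_level_iff hn).mp h1
    refine (mem_e_add_level_iff hn).mpr ⟨t', rfl, ?_⟩
    unfold monOrder at *
    split_ifs at * <;> omega
  · exact Set.subset_inter (Set.add_subset_add_left (level_anti (Nat.zero_le 1)))
      (H.e_add_level_subset 1)

theorem two_mul_mem (H : IsAdmissible b e l s c β) (p : ℕ) :
    2 * (b * e + 1) ∈ level b e l s β p ↔ p ≤ 2 := by
  have hs := H.two_le_s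
  have hsl := H.s_le
  have hle := H.le_e
  have h2 : 2 * (b * e + 1) = (aperyQuot b l β 2 + 0) * e + 2 := by
    rw [aperyQuot, if_pos (by omega)]; ring
  rw [h2, mem_level_iff (by omega), monOrder, if_pos (by omega)]

theorem two_mul_notMem (H : IsAdmissible b e l s c β) (p : ℕ) :
    2 * (b * e + 1) ∉ {e} + level b e l s β p := by
  have hs := H.two_le_s
  have hsl := H.s_le
  have hle := H.le_e
  have h2 : 2 * (b * e + 1) = (aperyQuot b l β 2 + 0) * e + 2 := by
    rw [aperyQuot, if_pos (by omega)]; ring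
  rw [h2, mem_e_add_level_iff (by omega)]
  rintro ⟨t', ht, -⟩
  omega

/-- Modulo `e + H` only `t = 0` survives, and there the order equals `2` for residue `2` alone. This
is the stretchedness condition on exponents. -/
theorem level_two_union (H : IsAdmissible b e l s c β) :
    level b e l s β 2 ∪ ({e} + level b e l s β 0) =
      level b e l s β 3 ∪ ({e} + level b e l s β 0) ∪ {2 * (b * e + 1)} := by
  have hs := H.two_le_s
  have hsl := H.s_le
  apply Set.Subset.antisymm
  · rintro _ (⟨n, t, hn, rfl, hp⟩ | h)
    · rcases t with _ | t
      · by_cases h2 : n = 2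
        · right
          subst h2
          rw [Set.mem_singleton_iff, aperyQuot, if_pos (by omega)]
          ring
        · refine Or.inl (Or.inl ⟨n, 0, hn, rfl, ?_⟩)
          unfold monOrder at *
          split_ifs at * <;> omega
      · exact Or.inl (Or.inr ((mem_e_add_level_iff hn).mpr ⟨t, rfl, Nat.zero_le _⟩))
    · exact Or.inl (Or.inr h)
  · rintro _ ((h | h) | rfl)
    · exact Or.inl (level_anti (by omega) h)
    · exact Or.inr h
    · exact Or.inl ((H.two_mul_mem 2).mpr le_rfl)

theorem l_mem_level (H : IsAdmissible b e l s c β) (p : ℕ) :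
    (aperyQuot b l β l + 0) * e + l ∈ level b e l s β p ↔ p ≤ l := by
  have hle := H.le_e
  rw [mem_level_iff (by omega), monOrder, if_pos le_rfl, add_zero]

theorem l_notMem (H : IsAdmissible b e l s c β) (p : ℕ) :
    (aperyQuot b l β l + 0) * e + l ∉ {e} + level b e l s β p := by
  have hle := H.le_e
  rw [mem_e_add_level_iff (by omega)]
  rintro ⟨t', ht, -⟩
  omega

theorem level_subset_e_add_level_zero_iff (H : IsAdmissible b e l s c β) (p : ℕ) :
    level b e l s β (p + 1) ⊆ {e} + level b e l s β 0 ↔ l ≤ p := by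
  have hs := H.two_le_s
  have hsl := H.s_le
  refine ⟨fun h => ?_, fun hp => ?_⟩
  · by_contra! hp
    exact H.l_notMem 0 (h ((H.l_mem_level (p + 1)).mpr hp))
  · rintro _ ⟨n, t, hn, rfl, ho⟩
    refine (mem_e_add_level_iff hn).mpr ⟨t - 1, ?_, Nat.zero_le _⟩
    unfold monOrder at *
    split_ifs at * <;> omega

theorem level_subset_e_add_level_iff (H : IsAdmissible b e l s c β) (p : ℕ) :
    level b e l s β (p + 1) ⊆ {e} + level b e l s β p ↔ l + 1 ≤ p := by
  have hs := H.two_le_s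
  have hsl := H.s_le
  have hle := H.le_e
  refine ⟨fun h => ?_, fun hp => ?_⟩
  · by_contra! hp
    rcases Nat.lt_or_ge p l with hp' | hp'
    · exact H.l_notMem p (h ((H.l_mem_level (p + 1)).mpr hp'))
    -- Here `p = l`. The exponent just after the jump has order `l + 1`, but subtracting `e` drops
    -- the order to `s - 1 < l`.
    · have h1 : (aperyQuot b l β (l + 1) + (s - 1)) * e + (l + 1) ∈ level b e l s β (p + 1) := by
        rw [mem_level_iff (by omega), monOrder, if_neg (by omega), if_pos (by omega)]
        omega
      obtain ⟨t', ht', ho⟩ := (mem_e_add_level_iff (by omega)).mp (h h1)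
      rw [monOrder, if_neg (by omega), if_neg (by omega)] at ho
      omega
  · rintro _ ⟨n, t, hn, rfl, ho⟩
    refine (mem_e_add_level_iff hn).mpr ⟨t - 1, ?_, ?_⟩ <;>
    · unfold monOrder at *
      split_ifs at * <;> omega

theorem inter_level_subset_iff (H : IsAdmissible b e l s c β) {p : ℕ} (hp : 1 ≤ p) :
    ({e} + level b e l s β (p - 1)) ∩ level b e l s β (p + 1) ⊆ {e} + level b e l s β p ↔
      p ≠ s := by
  have hs := H.two_le_s
  have hsl := H.s_le
  have hle := H.le_e
  constructor
  · rintro h rfl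
    -- The same exponent after the jump, with `p = s`: removing `e` leaves order exactly `p - 1`,
    -- although its own order `l + 1` is at least `p + 1`.
    have h1 := @h ((aperyQuot b l β (l + 1) + (p - 1)) * e + (l + 1)) ⟨by
      refine (mem_e_add_level_iff (by omega)).mpr ⟨p - 2, by omega, ?_⟩
      rw [monOrder, if_neg (by omega), if_neg (by omega)]
      omega, by
      rw [mem_level_iff (by omega), monOrder, if_neg (by omega), if_pos (by omega)]
      omega⟩
    obtain ⟨t', ht', ho⟩ := (mem_e_add_level_iff (by omega)).mp h1
    rw [monOrder, if_neg (by omega), if_neg (by omega)] at ho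
    omega
  · rintro hps _ ⟨h1, n, t, hn, rfl, ho⟩
    obtain ⟨t', rfl, ho'⟩ := (mem_e_add_level_iff hn).mp h1
    refine (mem_e_add_level_iff hn).mpr ⟨t', rfl, ?_⟩
    unfold monOrder at *
    split_ifs at * <;> omega

/-- The exponent of the monomial whose initial form lies in the socle of the associated graded
ring. -/
theorem socle_mem_level (H : IsAdmissible b e l s c β) (p : ℕ) :
    (aperyQuot b l β (l + 1) + (s - 2)) * e + (l + 1) ∈ level b e l s β p ↔ p ≤ s - 1 := by
  have hs := H.two_le_s
  have hle := H.le_e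
  rw [mem_level_iff (by omega), monOrder, if_neg (by omega), if_neg (by omega)]
  omega

/-- Adding `e` to the socle exponent reaches order `l + 1`, so adding `g` as well reaches order `l +
2`. From there on every exponent is `e` plus one of order at least `l + 1`, and cancelling `e` gives
the claim because `s ≤ l`. -/
theorem add_socle_mem_level (H : IsAdmissible b e l s c β) {g : ℕ} (hg : g ∈ level b e l s β 1) :
    g + ((aperyQuot b l β (l + 1) + (s - 2)) * e + (l + 1)) ∈ level b e l s β (s + 1) := by
  have hs := H.two_le_s
  have hsl := H.s_le
  have hle := H.le_e
  have h1 : (aperyQuot b l β (l + 1) + (s - 1)) * e + (l + 1) ∈ level b e l s β (l + 1) := by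
    rw [mem_level_iff (by omega), monOrder, if_neg (by omega), if_pos (by omega)]
    omega
  obtain ⟨a, ha, h, hh, heq⟩ :=
    (H.level_subset_e_add_level_iff (l + 1)).mpr le_rfl (H.add_mem_level hg h1)
  rw [Set.mem_singleton_iff.mp ha] at heq
  have h2 : s - 1 = s - 2 + 1 := by omega
  have h3 : (aperyQuot b l β (l + 1) + (s - 1)) * e + (l + 1) =
      e + ((aperyQuot b l β (l + 1) + (s - 2)) * e + (l + 1)) := by rw [h2]; ring
  have : h = g + ((aperyQuot b l β (l + 1) + (s - 2)) * e + (l + 1)) := by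
    simp only at heq; omega
  rw [← this]
  exact level_anti (by omega) hh

theorem mul_e_mem_level (H : IsAdmissible b e l s c β) (n p : ℕ) :
    n * e ∈ level b e l s β p ↔ p ≤ n := by
  have h0 : n * e = (aperyQuot b l β 0 + n) * e + 0 := by simp [aperyQuot]
  have hle := H.le_e
  rw [h0, mem_level_iff (by omega), monOrder, if_pos (Nat.zero_le _), zero_add]

/-- The number of monomials with exponent congruent to `r` modulo `e` and order at most `n`. -/
def residueCount (l s n r : ℕ) : ℕ :=
  if r ≤ l then n + 1 - r else if r = l + 1 then n + s - (l + 1) else n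

theorem monOrder_le_iff (H : IsAdmissible b e l s c β) {n r t : ℕ} (hn : l ≤ n) :
    ¬ n + 1 ≤ monOrder l s r t ↔ t < residueCount l s n r := by
  have hs := H.two_le_s
  have hsl := H.s_le
  unfold monOrder residueCount
  split_ifs <;> omega

theorem level_zero_diff_level (H : IsAdmissible b e l s c β) {n : ℕ} (hn : l ≤ n) :
    level b e l s β 0 \ level b e l s β (n + 1) =
      (fun x : (_ : ℕ) × ℕ => (aperyQuot b l β x.1 + x.2) * e + x.1) ''
        ((Finset.range e).sigma fun r => Finset.range (residueCount l s n r)) := by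
  ext h
  constructor
  · rintro ⟨⟨r, t, hr, rfl, -⟩, h2⟩
    rw [mem_level_iff hr, H.monOrder_le_iff hn] at h2
    exact ⟨⟨r, t⟩, by simpa using ⟨hr, h2⟩, rfl⟩
  · rintro ⟨⟨r, t⟩, hx, rfl⟩
    simp only [Finset.mem_coe, Finset.mem_sigma, Finset.mem_range] at hx
    refine ⟨⟨r, t, hx.1, rfl, Nat.zero_le _⟩, ?_⟩
    rw [mem_level_iff hx.1, H.monOrder_le_iff hn]
    exact hx.2

theorem finite_level_zero_diff_level (H : IsAdmissible b e l s c β) {n : ℕ} (hn : l ≤ n) :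
    (level b e l s β 0 \ level b e l s β (n + 1)).Finite := by
  rw [H.level_zero_diff_level hn]
  exact (Finset.finite_toSet _).image _

theorem sum_range_sub_id (n q : ℕ) (h : q ≤ n + 1) :
    (∑ r ∈ Finset.range q, ((n + 1 - r : ℕ) : ℤ)) = q * (n + 1) - q.choose 2 := by
  induction q with
  | zero => simp
  | succ q ih =>
    rw [Finset.sum_range_succ, ih (by omega), Nat.choose_succ_succ' q 1, Nat.choose_one_right]
    push_cast [Nat.cast_sub (show q ≤ n + 1 by omega)]
    ring

theorem ncard_level_zero_diff_level (H : IsAdmissible b e l s c β) {n : ℕ} (hn : l ≤ n) :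
    ((level b e l s β 0 \ level b e l s β (n + 1)).ncard : ℤ) =
      e * (n + 1) - (e - 1 + (l + 1).choose 2 - s + 1) := by
  have hs := H.two_le_s
  have hsl := H.s_le
  rw [H.level_zero_diff_level hn, Set.InjOn.ncard_image, Set.ncard_coe_finset,
    Finset.card_sigma]
  · simp only [Finset.card_range]
    -- The sum splits into residues up to `l`, the exceptional residue `l + 1`, and the remaining
    -- `d`, each contributing `n`.
    obtain ⟨d, hd⟩ : ∃ d, e = l + 1 + 1 + d := ⟨e - (l + 2), by have := H.le_e; omega⟩
    have h1 : ∀ r ∈ Finset.range (l + 1),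
        ((residueCount l s n r : ℕ) : ℤ) = ((n + 1 - r : ℕ) : ℤ) := fun r hr => by
      rw [residueCount, if_pos (by simpa [Nat.lt_succ_iff] using hr)]
    have h2 : residueCount l s n (l + 1) = n + s - (l + 1) := by
      rw [residueCount, if_neg (by omega), if_pos rfl]
    have h3 : ∀ i ∈ Finset.range d, ((residueCount l s n (l + 1 + 1 + i) : ℕ) : ℤ) = n :=
      fun i _ => by rw [residueCount, if_neg (by omega), if_neg (by omega)]
    have hcast : ((n + s - (l + 1) : ℕ) : ℤ) = n + s - (l + 1) := by omega
    rw [hd, Finset.sum_range_add, Finset.sum_range_succ]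
    push_cast
    rw [Finset.sum_congr rfl h1, Finset.sum_congr rfl h3, h2, sum_range_sub_id _ _ (by omega),
      hcast]
    simp only [Finset.sum_const, Finset.card_range, nsmul_eq_mul]
    push_cast
    ring
  · rintro ⟨r, t⟩ hx ⟨r', t'⟩ hx' h
    simp only [Finset.mem_coe, Finset.mem_sigma, Finset.mem_range] at hx hx' h
    have h2 := congrArg (· % e) h
    simp only [Nat.mul_add_mod_self_right, Nat.mod_eq_of_lt hx.1, Nat.mod_eq_of_lt hx'.1] at h2
    subst h2
    have h3 := Nat.eq_of_mul_eq_mul_right (by omega) (Nat.add_right_cancel h)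
    obtain rfl : t = t' := by omega
    rfl

end IsAdmissible

/-- The hypotheses on the exponents, with `⌈b / 2⌉` expressed in natural numbers. -/
theorem isAdmissible_of_ceil (hb : 2 ≤ b) (hs : 2 ≤ s) (hsl : s ≤ l) (hle : l + 3 ≤ e)
    (hβ₁ : (β (l + 1) : ℤ) = b * (l + 1) + 1 - s)
    (hβ₂ : (β (l + 2) : ℤ) = (b - 1) * (l + 2) + 1)
    (hlow : ∀ n : ℕ, l + 3 ≤ n → n < e → ⌈(b : ℚ) / 2⌉ * n + 1 ≤ (β n : ℤ))
    (hstep : ∀ n : ℕ, l + 2 ≤ n → n + 1 < e → (β (n + 1) : ℤ) ≤ β n + ⌈(b : ℚ) / 2⌉) :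
    IsAdmissible b e l s ((b + 1) / 2) β := by
  -- With this value of `c`, the hypothesis `2 ≤ b` yields the strict inequality `c < b`.
  have hc : ⌈(b : ℚ) / 2⌉ = (((b + 1) / 2 : ℕ) : ℤ) := by
    have h1 : (b : ℚ) ≤ 2 * ((b + 1) / 2 : ℕ) := by
      have : b ≤ 2 * ((b + 1) / 2) := by omega
      exact_mod_cast this
    have h2 : 2 * (((b + 1) / 2 : ℕ) : ℚ) ≤ b + 1 := by
      have : 2 * ((b + 1) / 2) ≤ b + 1 := by omega
      exact_mod_cast this
    rw [Int.ceil_eq_iff, Int.cast_natCast]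
    constructor <;> linarith
  rw [hc] at hlow hstep
  refine ⟨by omega, by omega, hs, hsl, hle, ?_, ?_, fun n h1 h2 => by exact_mod_cast hlow n h1 h2,
    fun n h1 h2 => by exact_mod_cast hstep n h1 h2⟩
  · zify; linarith
  · zify; linarith

end LevelSets

/-! ### Transfer of the invariants to the local ring. -/

section LocalRing

open scoped Pointwise

variable (k : Type*) [Field k] {b e l s c : ℕ} {β : ℕ → ℕ}

instance : IsNoetherianRing (LocRing k b e l β) := by
  have hfin : (semigroupGens b e l β).Finite := by
    refine (Set.toFinite {e, b * e + 1}).union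
      (((Set.finite_Iio e).image fun n => β n * e + n).subset ?_)
    rintro _ ⟨n, -, hn, rfl⟩
    exact ⟨n, hn, rfl⟩
  have : IsNoetherianRing (semigroupRing k b e l β) :=
    isNoetherianRing_of_fg (Subalgebra.fg_def.mpr ⟨_, hfin.image _, rfl⟩)
  exact IsLocalization.isNoetherianRing (gradedMax k b e l β).primeCompl _ this

instance : IsDomain (LocRing k b e l β) :=
  IsLocalization.isDomain_of_atPrime _ (gradedMax k b e l β)

theorem infinite_residueField [Infinite k] :
    Infinite (IsLocalRing.ResidueField (LocRing k b e l β)) :=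
  Infinite.of_injective
    ((IsLocalRing.residue (LocRing k b e l β)).comp ((algebraMap (semigroupRing k b e l β)
      (LocRing k b e l β)).comp (algebraMap k (semigroupRing k b e l β))))
    (RingHom.injective _)

namespace IsAdmissible

theorem paramIdeal_le (H : IsAdmissible b e l s c β) :
    paramIdeal k b e l β ≤ maxIdeal k b e l β := by
  rw [H.paramIdeal_eq k, ← pow_one (maxIdeal k b e l β), H.maxIdeal_pow k]
  exact locIdeal_mono k b e l β (H.e_add_level_subset 0)

theorem isNilpotencyIndex (H : IsAdmissible b e l s c β) :
    IsNilpotencyIndex (paramIdeal k b e l β) (maxIdeal k b e l β) l := by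
  have key (n : ℕ) : maxIdeal k b e l β ^ (n + 1) ≤ paramIdeal k b e l β ↔ l ≤ n := by
    rw [H.paramIdeal_eq k, H.maxIdeal_pow k, H.locIdeal_le_iff k (level_anti (Nat.zero_le _))
      (H.isSemigroupIdeal_add_level H.e_mem 0), H.level_subset_e_add_level_zero_iff]
  exact ⟨(key l).mpr le_rfl, fun n hn => (key n).mp hn⟩

theorem isReductionNumber (H : IsAdmissible b e l s c β) :
    IsReductionNumber (paramIdeal k b e l β) (maxIdeal k b e l β) (l + 1) := by
  have key (n : ℕ) : maxIdeal k b e l β ^ (n + 1) =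
      paramIdeal k b e l β * maxIdeal k b e l β ^ n ↔ l + 1 ≤ n := by
    rw [H.paramIdeal_mul_pow k, H.maxIdeal_pow k, ← H.level_subset_e_add_level_iff,
      ← H.locIdeal_le_iff k (level_anti (Nat.zero_le _)) (H.isSemigroupIdeal_add_level H.e_mem n)]
    exact ⟨fun h => h.le, fun h => h.antisymm (locIdeal_mono k b e l β (H.e_add_level_subset n))⟩
  exact ⟨(key (l + 1)).mpr le_rfl, fun n hn => (key n).mp hn⟩

theorem lam_eq (H : IsAdmissible b e l s c β) :
    Lam (paramIdeal k b e l β) (maxIdeal k b e l β) = {s} := by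
  have key (n : ℕ) (hn : 1 ≤ n) : Nontrivial (SubQuot
      (paramIdeal k b e l β * maxIdeal k b e l β ^ (n - 1) ⊓ maxIdeal k b e l β ^ (n + 1))
      (paramIdeal k b e l β * maxIdeal k b e l β ^ n)) ↔ n = s := by
    rw [nontrivial_subQuot_iff, H.paramIdeal_mul_pow k, H.paramIdeal_mul_pow k, H.maxIdeal_pow k,
      H.locIdeal_inf k (H.isSemigroupIdeal_add_level H.e_mem _) (H.isSemigroupIdeal_level _),
      H.locIdeal_le_iff k (Set.inter_subset_right.trans (level_anti (Nat.zero_le _)))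
        (H.isSemigroupIdeal_add_level H.e_mem n), H.inter_level_subset_iff hn, not_not]
  ext n
  constructor
  · rintro ⟨hn, h⟩
    exact (key n hn).mp h
  · rintro rfl
    have : 1 ≤ n := by have := H.two_le_s; omega
    exact ⟨this, (key n this).mpr rfl⟩

theorem radical_paramIdeal (H : IsAdmissible b e l s c β) :
    (paramIdeal k b e l β).radical = maxIdeal k b e l β := by
  refine le_antisymm ?_ fun x hx =>
    ⟨l + 1, (H.isNilpotencyIndex k).1 (Ideal.pow_mem_pow hx (l + 1))⟩
  rw [← (inferInstance : (maxIdeal k b e l β).IsPrime).radical]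
  exact Ideal.radical_mono (H.paramIdeal_le k)

theorem locMon_e_mem (H : IsAdmissible b e l s c β) :
    locMon k b e l β e ∈ maxIdeal k b e l β := by
  refine H.paramIdeal_le k ?_
  rw [H.paramIdeal_eq_span k]
  exact Ideal.mem_span_singleton_self _

theorem locMon_pow (H : IsAdmissible b e l s c β) (n : ℕ) :
    locMon k b e l β e ^ n = locMon k b e l β (n * e) := by
  induction n with
  | zero =>
    rw [pow_zero, zero_mul, H.locMon_eq k H.zero_mem_level,
      ← map_one (algebraMap (semigroupRing k b e l β) (LocRing k b e l β))]
    congr 1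
  | succ n ih =>
    rw [pow_succ, ih, Nat.succ_mul, H.locMon_add k ((H.mul_e_mem_level n 0).mpr (Nat.zero_le n))
      H.e_mem]

theorem locMon_pow_notMem (H : IsAdmissible b e l s c β) (n : ℕ) :
    locMon k b e l β e ^ n ∉ maxIdeal k b e l β ^ (n + 1) := by
  rw [H.locMon_pow k, H.maxIdeal_pow k, H.locMon_mem_iff k (H.isSemigroupIdeal_level _)
    ((H.mul_e_mem_level n 0).mpr (Nat.zero_le n)), H.mul_e_mem_level]
  omega

theorem locMon_e_ne_zero (H : IsAdmissible b e l s c β) : locMon k b e l β e ≠ 0 := by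
  intro h
  have := H.locMon_pow_notMem k 1
  rw [pow_one, h] at this
  exact this (zero_mem _)

theorem ringKrullDim_locRing (H : IsAdmissible b e l s c β) :
    ringKrullDim (LocRing k b e l β) = 1 := by
  -- The radical of `Q` is `𝔪`, so Krull's principal ideal theorem bounds the height by one; the
  -- nonzerodivisor `u ^ e` gives the lower bound.
  have hmin : maxIdeal k b e l β ∈
      (Ideal.span {locMon k b e l β e} : Ideal (LocRing k b e l β)).minimalPrimes := by
    rw [← H.paramIdeal_eq_span k]
    refine ⟨⟨inferInstance, H.paramIdeal_le k⟩, fun J hJ _ => ?_⟩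
    rw [← H.radical_paramIdeal k, hJ.1.radical_le_iff]
    exact hJ.2
  have h1 := Ideal.height_le_one_of_isPrincipal_of_mem_minimalPrimes _ _ hmin
  have h2 : (Ideal.span {locMon k b e l β e}).height ≤ (maxIdeal k b e l β).height :=
    Ideal.height_mono ((Ideal.span_singleton_le_iff_mem _).mpr (H.locMon_e_mem k))
  rw [Ideal.height_span_singleton_eq_one_of_mem_nonZeroDivisors
    (mem_nonZeroDivisors_of_ne_zero (H.locMon_e_ne_zero k))
    (by simpa using H.locMon_e_mem k)] at h2
  rw [← IsLocalRing.maximalIdeal_height_eq_ringKrullDim, le_antisymm h1 h2]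
  rfl

theorem isCohenMacaulayLocal (H : IsAdmissible b e l s c β) :
    IsCohenMacaulayLocal (LocRing k b e l β) := by
  refine ⟨inferInstance, [locMon k b e l β e], ⟨?_, ?_⟩, ?_⟩
  · rw [RingTheory.Sequence.isWeaklyRegular_singleton_iff]
    exact IsSMulRegular.of_ne_zero (H.locMon_e_ne_zero k)
  · intro h
    rw [Ideal.ofList_singleton, smul_eq_mul, Ideal.mul_top] at h
    have h1 := (Ideal.span_singleton_le_iff_mem _).mpr (H.locMon_e_mem k)
    rw [← h] at h1
    exact (inferInstance : (maxIdeal k b e l β).IsPrime).ne_top (top_le_iff.mp h1)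
  · rw [H.ringKrullDim_locRing k]
    rfl

theorem isStretched (H : IsAdmissible b e l s c β) :
    IsStretched (paramIdeal k b e l β) (maxIdeal k b e l β) where
  primary := (inferInstance : (maxIdeal k b e l β).IsPrime).radical
  parameter := ⟨H.radical_paramIdeal k, 1, fun _ => locMon k b e l β e,
    by rw [H.ringKrullDim_locRing k]; rfl, by rw [H.paramIdeal_eq_span k, Set.range_const]⟩
  reduction := ⟨H.paramIdeal_le k, l + 1, (H.isReductionNumber k).1⟩
  inf_sq := by
    conv_rhs => rw [← pow_one (maxIdeal k b e l β), H.paramIdeal_mul_pow k]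
    rw [H.paramIdeal_eq k, H.maxIdeal_pow k, H.locIdeal_inf k
      (H.isSemigroupIdeal_add_level H.e_mem 0) (H.isSemigroupIdeal_level 2), H.inter_level_two]
  length_eq_one := by
    have h0 : 2 * (b * e + 1) ∈ level b e l s β 0 := (H.two_mul_mem 0).mpr (by omega)
    rw [H.paramIdeal_eq k, H.maxIdeal_pow k, H.maxIdeal_pow k, ← locIdeal_union, ← locIdeal_union]
    refine length_subQuot_eq_one (y := locMon k b e l β (2 * (b * e + 1))) ?_ ?_ ?_
    · rw [← H.locIdeal_singleton k h0, ← locIdeal_union, H.level_two_union]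
    · rw [H.locMon_mem_iff k ((H.isSemigroupIdeal_level 3).union
        (H.isSemigroupIdeal_add_level H.e_mem 0)) h0]
      rintro (h | h)
      · have := (H.two_mul_mem 3).mp h
        omega
      · exact H.two_mul_notMem 0 h
    · exact fun r hr => H.mul_locMon_mem k h0
        (fun g hg => Or.inl (H.add_mem_level hg ((H.two_mul_mem 2).mpr le_rfl))) hr

theorem length_quotient_maxIdeal_pow (H : IsAdmissible b e l s c β) {n : ℕ} (hn : l ≤ n) :
    Module.length (LocRing k b e l β) (LocRing k b e l β ⧸ maxIdeal k b e l β ^ (n + 1)) =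
      (level b e l s β 0 \ level b e l s β (n + 1)).ncard := by
  rw [H.maxIdeal_pow k, H.length_quotient_locIdeal k (H.isSemigroupIdeal_level _)
    (H.finite_level_zero_diff_level hn)]

theorem not_isCohenMacaulay_associatedGraded (H : IsAdmissible b e l s c β) :
    ¬ IsCohenMacaulay (AssociatedGraded (maxIdeal k b e l β)) := by
  have hs := H.two_le_s
  have h0 := (H.socle_mem_level 0).mpr (Nat.zero_le _)
  refine StretchedIdeal.not_isCohenMacaulay_associatedGraded (j := s - 1)
    (ξ := locMon k b e l β ((aperyQuot b l β (l + 1) + (s - 2)) * e + (l + 1)))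
    (a := locMon k b e l β e) ?_ ?_ ?_ (H.locMon_e_mem k) ?_
  · rw [H.maxIdeal_pow k, H.locMon_mem_iff k (H.isSemigroupIdeal_level _) h0, H.socle_mem_level]
  · rw [H.maxIdeal_pow k, H.locMon_mem_iff k (H.isSemigroupIdeal_level _) h0, H.socle_mem_level]
    omega
  · intro r hr
    have h1 : s - 1 + 2 = s + 1 := by omega
    rw [h1, H.maxIdeal_pow k]
    exact H.mul_locMon_mem k h0 (fun g hg => H.add_socle_mem_level hg) hr
  -- Outside `𝔪` every `σ` is a unit, so it suffices that `n * e` has order exactly `n`.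
  · intro n σ hσ h
    have hu : IsUnit σ := by simpa using hσ
    exact H.locMon_pow_notMem k n ((Ideal.unit_mul_mem_iff_mem _ hu).mp h)

end IsAdmissible

end LocalRing

end StretchedIdeal

end

open StretchedIdeal in
theorem corollary6p7 (k : Type*) [Field k] (b e l s : ℕ) (β : ℕ → ℕ)
    (hb : 2 ≤ b) (hs : 2 ≤ s) (hsl : s ≤ l) (hle : l + 3 ≤ e)
    (hβ₁ : (β (l + 1) : ℤ) = b * (l + 1) + 1 - s)
    (hβ₂ : (β (l + 2) : ℤ) = (b - 1) * (l + 2) + 1)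
    (hlow : ∀ n : ℕ, l + 3 ≤ n → n < e → ⌈(b : ℚ) / 2⌉ * n + 1 ≤ (β n : ℤ))
    (hstep : ∀ n : ℕ, l + 2 ≤ n → n + 1 < e → (β (n + 1) : ℤ) ≤ β n + ⌈(b : ℚ) / 2⌉) :
    -- `A` is a Cohen-Macaulay local ring of dimension one, and `𝔪` is stretched with respect to `Q`
    IsCohenMacaulayLocal (LocRing k b e l β) ∧
    ringKrullDim (LocRing k b e l β) = 1 ∧
    (Infinite k → Infinite (IsLocalRing.ResidueField (LocRing k b e l β))) ∧
    IsStretched (paramIdeal k b e l β) (maxIdeal k b e l β) ∧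
    -- index of nilpotency, reduction number and the set `Λ`
    IsNilpotencyIndex (paramIdeal k b e l β) (maxIdeal k b e l β) l ∧
    IsReductionNumber (paramIdeal k b e l β) (maxIdeal k b e l β) (l + 1) ∧
    Lam (paramIdeal k b e l β) (maxIdeal k b e l β) = {s} ∧
    -- the Hilbert function
    (∀ n : ℕ, l ≤ n → ∃ L : ℕ,
      Module.length (LocRing k b e l β)
        (LocRing k b e l β ⧸ maxIdeal k b e l β ^ (n + 1)) = L ∧
      (L : ℤ) = e * (n + 1) - (e - 1 + (l + 1).choose 2 - s + 1)) ∧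
    -- the associated graded ring
    ¬ IsCohenMacaulay (AssociatedGraded (maxIdeal k b e l β)) := by
  have H := isAdmissible_of_ceil hb hs hsl hle hβ₁ hβ₂ hlow hstep
  exact ⟨H.isCohenMacaulayLocal k, H.ringKrullDim_locRing k, fun _ => infinite_residueField k,
    H.isStretched k, H.isNilpotencyIndex k, H.isReductionNumber k, H.lam_eq k,
    fun n hn => ⟨_, H.length_quotient_maxIdeal_pow k hn, H.ncard_level_zero_diff_level hn⟩,
    H.not_isCohenMacaulay_associatedGraded k⟩
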